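/- Let $X$ be a set and let $X'=\{x' : x\in X\}$ be a disjoint copy of $X$. Let $\mathcal{C}_X$ be the set of all partitions of $X\cup X'$ into nonempty blocks. The natural product $\alpha\beta$ of $\alpha,\beta\in\mathcal{C}_X$ is obtained by drawing $\alpha$ above $\beta$ (with $X$ on top and $X'$ at the bottom), identifying each bottom vertex $x'$ of $\alpha$ with the top vertex $x$ of $\beta$, and recording which of the remaining vertices (top vertices of $\alpha$, bottom vertices of $\beta$) are connected. A *point* is a one-element subset of $X\cup X'$, a *generalised line* is a subset meeting both $X$ and $X'$, and a *line* is a generalised line with exactly two elements. Let $\mathcal{I}^*_X\subseteq\mathcal{C}_X$ be the subsemigroup of the partitions all of whose blocks are generalised lines, and let $\mathcal{PI}^*_X$ be the set of all partitions of $X\cup X'$ each of whose blocks is a point or a generalised line. Fix $\bar x\notin X$; for $\alpha\in\mathcal{PI}^*_X$ let $\bar\alpha\in\mathcal{I}^*_{X\cup\{\bar x\}}$ be the partition whose blocks are the generalised lines of $\alpha$ and the block consisting of $\bar x$, $\bar x'$ and all vertices that are points of $\alpha$. Then $\mathcal{PI}^*_X$ is a monoid under the product $\alpha\star\beta$ defined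 by $\overline{\alpha\star\beta}=\bar\alpha\,\bar\beta$ (natural product on the right). The rank of $\alpha\in\mathcal{PI}^*_X$ is the number of its generalised lines. Let $\mathcal{N}=\{1,\dots,n\}$ and write $\mathcal{PI}^*_n=\mathcal{PI}^*_{\mathcal{N}}$. For $Y\subseteq\mathcal{N}$ identify $\mathcal{I}^*_Y$ with the set of those $\alpha\in\mathcal{PI}^*_n$ whose points are exactly the $t$ and $t'$ with $t\in\mathcal{N}\setminus Y$, and let $\mathcal{S}_Y\subseteq\mathcal{I}^*_Y$ be the set (a copy of the symmetric group on $Y$) of those elements all of whose generalised lines are lines; put $\mathcal{I}^*_n=\mathcal{I}^*_{\mathcal{N}}$ and $\mathcal{S}_n=\mathcal{S}_{\mathcal{N}}$. For an idempotent $e$ let $G(e)$ be the maximal subgroup of $\mathcal{PI}^*_n$ with identity element $e$. A (nonempty) subsemigroup $T$ of a semigroup $S$ is called *isolated* if, for all $a\in S$ and $k\ge 1$, $a^k\in T$ implies $a\in T$. **Theorem.** Let $n\ge 3$. A subset $T$ of $\mathcal{PI}^*_n$ is an isolated subsemigroup of $\mathcal{PI}^*_n$ if and only if it is one of the following: 1.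 $\mathcal{I}^*_n$, $\ \mathcal{I}^*_n\setminus\mathcal{S}_n$, $\ \mathcal{S}_n$, or $G(e)$ for an idempotent $e$ of $\mathcal{I}^*_n$ of rank $n-1$; 2. $\mathcal{I}^*_Y$, $\ \mathcal{I}^*_Y\setminus\mathcal{S}_Y$, $\ \mathcal{S}_Y$, or $G(e)$ for an idempotent $e$ of $\mathcal{I}^*_Y$ of rank $n-2$, where $Y=\mathcal{N}\setminus\{t\}$ with $t\in\mathcal{N}$; 3. $\mathcal{PI}^*_n$ or $\mathcal{PI}^*_n\setminus\mathcal{S}_n$. -/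

import Mathlib

/-! Partition diagrams on `X ∪ X'`.  The disjoint union `X ∪ X'` is modelled by `X ⊕ X`: the top
vertex `x` is `Sum.inl x` and the bottom vertex `x'` is `Sum.inr x`.  A partition of `X ∪ X'` into
nonempty blocks is an equivalence relation; its blocks are `Setoid.classes`. -/

namespace PartitionDiagram

universe u

/-- The carrier of `C_X`: all partitions of `X ∪ X'`. -/
abbrev Diagram (X : Type u) : Type u := Setoid (X ⊕ X)

/-- A point: a one-element set of vertices. -/
def IsPoint {X : Type u} (B : Set (X ⊕ X)) : Prop := ∃ v, B = {v}

/-- A generalised line: a set of vertices meeting both `X` and `X'`. -/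
def IsGeneralisedLine {X : Type u} (B : Set (X ⊕ X)) : Prop :=
  (∃ x, Sum.inl x ∈ B) ∧ ∃ y, Sum.inr y ∈ B

/-- A line: a generalised line with exactly two vertices. -/
def IsLine {X : Type u} (B : Set (X ⊕ X)) : Prop := IsGeneralisedLine B ∧ B.ncard = 2

/-- Two diagrams are stacked on three rows `X ⊕ (X ⊕ X)` of vertices: the first diagram occupies
the top and the middle row. -/
def upper {X : Type u} : X ⊕ X → X ⊕ (X ⊕ X) := Sum.map id Sum.inl

/-- The second diagram occupies the middle and the bottom row. -/
def lower {X : Type u} : X ⊕ X → X ⊕ (X ⊕ X) := Sum.inr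

/-- The product lives on the top and the bottom row. -/
def outer {X : Type u} : X ⊕ X → X ⊕ (X ⊕ X) := Sum.map id Sum.inr

/-- Connectedness in the stacked diagram: the equivalence relation generated by both diagrams. -/
def stack {X : Type u} (α β : Diagram X) : Setoid (X ⊕ (X ⊕ X)) :=
  Relation.EqvGen.setoid fun p q =>
    (∃ u v, α u v ∧ upper u = p ∧ upper v = q) ∨ (∃ u v, β u v ∧ lower u = p ∧ lower v = q)

/-- The natural multiplication of `C_X`. -/
def natMul {X : Type u} (α β : Diagram X) : Diagram X := (stack α β).comap outer

/-- The diagrams all of whose blocks are generalised lines: the elements of `I*_X`. -/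
def IsDual {X : Type u} (α : Diagram X) : Prop := ∀ B ∈ α.classes, IsGeneralisedLine B

/-! Basic facts about the natural multiplication. -/

theorem stack_imp {X : Type u} {α β : Diagram X} {F : X ⊕ (X ⊕ X) → Prop}
    (hα : ∀ u v, α u v → F (upper u) → F (upper v))
    (hβ : ∀ u v, β u v → F (lower u) → F (lower v)) {p q : X ⊕ (X ⊕ X)}
    (h : stack α β p q) : F p → F q := by
  have h' : Relation.EqvGen _ p q := h
  clear h
  have key : F p ↔ F q := by
    induction h' with
    | rel p q hpq =>
      rcases hpq with ⟨u, v, huv, rfl, rfl⟩ | ⟨u, v, huv, rfl, rfl⟩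
      · exact ⟨hα _ _ huv, hα _ _ (α.symm huv)⟩
      · exact ⟨hβ _ _ huv, hβ _ _ (β.symm huv)⟩
    | refl p => exact Iff.rfl
    | symm p q h ih => exact ih.symm
    | trans p q r h₁ h₂ ih₁ ih₂ => exact ih₁.trans ih₂
  exact key.1

theorem stack_upper {X : Type u} {α β : Diagram X} {u v : X ⊕ X} (h : α u v) :
    stack α β (upper u) (upper v) :=
  Relation.EqvGen.rel _ _ (Or.inl ⟨u, v, h, rfl, rfl⟩)

theorem stack_lower {X : Type u} {α β : Diagram X} {u v : X ⊕ X} (h : β u v) :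
    stack α β (lower u) (lower v) :=
  Relation.EqvGen.rel _ _ (Or.inr ⟨u, v, h, rfl, rfl⟩)

theorem natMul_iff {X : Type u} {α β : Diagram X} {a b : X ⊕ X} :
    natMul α β a b ↔ ∀ F : X ⊕ (X ⊕ X) → Prop,
      (∀ u v, α u v → F (upper u) → F (upper v)) →
      (∀ u v, β u v → F (lower u) → F (lower v)) → F (outer a) → F (outer b) := by
  constructor
  · intro h F hα hβ
    exact stack_imp hα hβ h
  · intro h
    exact h (fun q => stack α β (outer a) q)
      (fun u v huv hu => (stack α β).trans hu (stack_upper huv))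
      (fun u v huv hu => (stack α β).trans hu (stack_lower huv)) ((stack α β).refl _)

/-- Reflection of a diagram in the horizontal axis. -/
def reflect {X : Type u} (α : Diagram X) : Diagram X := α.comap Sum.swap

theorem reflect_rel {X : Type u} {α : Diagram X} {a b : X ⊕ X} :
    reflect α a b ↔ α a.swap b.swap := Iff.rfl

theorem reflect_reflect {X : Type u} (α : Diagram X) : reflect (reflect α) = α := by
  ext a b
  rw [reflect_rel, reflect_rel, Sum.swap_swap, Sum.swap_swap]

theorem natMul_reflect_le {X : Type u} {α β : Diagram X} {a b : X ⊕ X} (h : natMul α β a b) :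
    natMul (reflect β) (reflect α) a.swap b.swap := by
  rw [natMul_iff] at h ⊢
  intro F hβ hα ha
  have e₁ : ∀ u : X ⊕ X, (Sum.elim (Sum.inr ∘ Sum.inr) (Sum.elim (Sum.inr ∘ Sum.inl) Sum.inl) :
      X ⊕ (X ⊕ X) → X ⊕ (X ⊕ X)) (upper u) = lower u.swap := by
    rintro (x | x) <;> rfl
  have e₂ : ∀ u : X ⊕ X, (Sum.elim (Sum.inr ∘ Sum.inr) (Sum.elim (Sum.inr ∘ Sum.inl) Sum.inl) :
      X ⊕ (X ⊕ X) → X ⊕ (X ⊕ X)) (lower u) = upper u.swap := by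
    rintro (x | x) <;> rfl
  have e₃ : ∀ u : X ⊕ X, (Sum.elim (Sum.inr ∘ Sum.inr) (Sum.elim (Sum.inr ∘ Sum.inl) Sum.inl) :
      X ⊕ (X ⊕ X) → X ⊕ (X ⊕ X)) (outer u) = outer u.swap := by
    rintro (x | x) <;> rfl
  have := h (fun p => F ((Sum.elim (Sum.inr ∘ Sum.inr)
    (Sum.elim (Sum.inr ∘ Sum.inl) Sum.inl) : X ⊕ (X ⊕ X) → X ⊕ (X ⊕ X)) p))
  simp only [e₁, e₂, e₃] at this
  exact this (fun u v huv => hα _ _ (by rwa [reflect_rel, Sum.swap_swap, Sum.swap_swap]))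
    (fun u v huv => hβ _ _ (by rwa [reflect_rel, Sum.swap_swap, Sum.swap_swap])) ha

theorem reflect_natMul {X : Type u} (α β : Diagram X) :
    reflect (natMul α β) = natMul (reflect β) (reflect α) := by
  ext a b
  constructor
  · intro h
    simpa using natMul_reflect_le (show natMul α β a.swap b.swap from h)
  · intro h
    have := natMul_reflect_le h
    rwa [reflect_reflect, reflect_reflect] at this

theorem natMul_assoc_le {X : Type u} {α β γ : Diagram X} {a b : X ⊕ X}
    (h : natMul (natMul α β) γ a b) : natMul α (natMul β γ) a b := by
  rw [natMul_iff] at h ⊢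
  intro F hα hβγ ha
  -- `K p`: some vertex of the two outer rows of `stack β γ` is connected to `p` and satisfies `F`
  let K : X ⊕ (X ⊕ X) → Prop := fun p => ∃ w : X ⊕ X, stack β γ p (outer w) ∧ F (lower w)
  have hK : ∀ u : X ⊕ X, K (outer u) ↔ F (lower u) := fun u =>
    ⟨fun ⟨w, hw, hF⟩ => hβγ w u ((stack β γ).symm hw) hF, fun hF => ⟨u, (stack β γ).refl _, hF⟩⟩
  have hKs : ∀ {p q}, stack β γ p q → K p → K q := fun hpq ⟨w, hw, hF⟩ =>
    ⟨w, (stack β γ).trans ((stack β γ).symm hpq) hw, hF⟩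
  let F' : X ⊕ (X ⊕ X) → Prop := Sum.elim (fun x => F (Sum.inl x)) (fun v => K (lower v))
  have h1 : ∀ u : X ⊕ X, F' (outer u) ↔ F (outer u) := by
    rintro (x | x)
    · exact Iff.rfl
    · exact hK (Sum.inr x)
  rw [← h1 b]
  refine h F' ?_ (fun u v huv => hKs (stack_lower huv)) ((h1 a).2 ha)
  intro u v huv
  -- the three rows of `stack α β`
  let G : X ⊕ (X ⊕ X) → Prop := Sum.elim (fun x => F (Sum.inl x)) (fun v => K (upper v))
  have g1 : ∀ w : X ⊕ X, G (upper w) ↔ F (upper w) := by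
    rintro (x | x)
    · exact Iff.rfl
    · exact hK (Sum.inl x)
  have g2 : ∀ w : X ⊕ X, G (outer w) ↔ F' (upper w) := by
    rintro (x | x) <;> exact Iff.rfl
  rw [← g2, ← g2]
  refine (natMul_iff.1 huv) G ?_ (fun u v huv => hKs (stack_upper huv))
  intro u v huv
  rw [g1, g1]
  exact hα u v huv

theorem natMul_assoc {X : Type u} (α β γ : Diagram X) :
    natMul (natMul α β) γ = natMul α (natMul β γ) := by
  ext a b
  refine ⟨natMul_assoc_le, fun h => ?_⟩
  have h' : reflect (natMul α (natMul β γ)) a.swap b.swap := by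
    rwa [reflect_rel, Sum.swap_swap, Sum.swap_swap]
  rw [reflect_natMul, reflect_natMul] at h'
  have h2 := natMul_assoc_le h'
  rw [← reflect_natMul, ← reflect_natMul] at h2
  rwa [reflect_rel, Sum.swap_swap, Sum.swap_swap] at h2

theorem isDual_iff {X : Type u} {α : Diagram X} :
    IsDual α ↔ ∀ v, (∃ x, α v (Sum.inl x)) ∧ ∃ y, α v (Sum.inr y) := by
  constructor
  · intro h v
    obtain ⟨⟨x, hx⟩, ⟨y, hy⟩⟩ := h _ (α.mem_classes v)
    exact ⟨⟨x, α.symm hx⟩, ⟨y, α.symm hy⟩⟩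
  · rintro h B ⟨v, rfl⟩
    obtain ⟨⟨x, hx⟩, ⟨y, hy⟩⟩ := h v
    exact ⟨⟨x, α.symm hx⟩, ⟨y, α.symm hy⟩⟩

/-- `I*_X` is closed under the natural multiplication. -/
theorem IsDual.natMul {X : Type u} {α β : Diagram X} (hα : IsDual α) (hβ : IsDual β) :
    IsDual (natMul α β) := by
  rw [isDual_iff] at *
  rintro (x | x)
  · refine ⟨⟨x, Setoid.refl' _ _⟩, ?_⟩
    obtain ⟨y, hy⟩ := (hα (Sum.inl x)).2
    obtain ⟨z, hz⟩ := (hβ (Sum.inl y)).2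
    exact ⟨z, (stack α β).trans (stack_upper hy) (stack_lower hz)⟩
  · refine ⟨?_, ⟨x, Setoid.refl' _ _⟩⟩
    obtain ⟨y, hy⟩ := (hβ (Sum.inr x)).1
    obtain ⟨z, hz⟩ := (hα (Sum.inr y)).1
    exact ⟨z, (stack α β).trans (stack_lower hy) (stack_upper hz)⟩

/-- The carrier of `PI*_X`: the partitions of `X ∪ X'` whose blocks are points or generalised
lines. -/
@[ext]
structure PIStar (X : Type u) : Type u where
  rel : Diagram X
  blocks : ∀ B ∈ rel.classes, IsPoint B ∨ IsGeneralisedLine B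

namespace PIStar

theorem class_eq {X : Type u} (α : Diagram X) (v : X ⊕ X) :
    ({v} ∈ α.classes) ↔ ∀ w, α v w → w = v := by
  constructor
  · rintro ⟨y, hy⟩ w hw
    have hv : α v y := by
      have : v ∈ ({v} : Set (X ⊕ X)) := rfl
      rwa [hy] at this
    have : w ∈ {x | α x y} := α.trans (α.symm hw) hv
    rwa [← hy] at this
  · intro h
    refine ⟨v, ?_⟩
    ext w
    constructor
    · rintro rfl
      exact α.refl _
    · intro hw
      exact h w (α.symm hw)

theorem blocks_iff {X : Type u} {α : Diagram X} :
    (∀ B ∈ α.classes, IsPoint B ∨ IsGeneralisedLine B) ↔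
      ∀ v, {v} ∈ α.classes ∨ ((∃ x, α v (Sum.inl x)) ∧ ∃ y, α v (Sum.inr y)) := by
  constructor
  · intro h v
    rcases h _ (α.mem_classes v) with ⟨w, hw⟩ | ⟨⟨x, hx⟩, ⟨y, hy⟩⟩
    · left
      have : v ∈ {x | α x v} := α.refl v
      rw [hw] at this
      obtain rfl : v = w := this
      rw [← hw]
      exact α.mem_classes v
    · exact Or.inr ⟨⟨x, α.symm hx⟩, ⟨y, α.symm hy⟩⟩
  · rintro h B ⟨v, rfl⟩
    rcases h v with hv | ⟨⟨x, hx⟩, ⟨y, hy⟩⟩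
    · left
      refine ⟨v, ?_⟩
      ext w
      constructor
      · intro hw
        exact (class_eq α v).1 hv w (α.symm hw)
      · rintro rfl
        exact α.refl _
    · exact Or.inr ⟨⟨x, α.symm hx⟩, ⟨y, α.symm hy⟩⟩

/-- The vertex of `(X ∪ {x̄}) ∪ (X ∪ {x̄})'` given by a vertex of `X ∪ X'`; here `X ∪ {x̄}` is
`Option X` and `x̄` is `none`. -/
def lift {X : Type u} : X ⊕ X → Option X ⊕ Option X := Sum.map some some

/-- The vertices of the extra block of `ᾱ`: the two vertices `x̄`, `x̄'` and all points of `α`. -/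
def Special {X : Type u} (α : Diagram X) (p : Option X ⊕ Option X) : Prop :=
  p = Sum.inl none ∨ p = Sum.inr none ∨ ∃ v, p = lift v ∧ {v} ∈ α.classes

theorem lift_injective {X : Type u} : Function.Injective (lift (X := X)) :=
  Sum.map_injective.2 ⟨Option.some_injective X, Option.some_injective X⟩

theorem special_lift {X : Type u} {α : Diagram X} {v : X ⊕ X} :
    Special α (lift v) ↔ {v} ∈ α.classes := by
  constructor
  · rintro (h | h | ⟨w, h, hw⟩)
    · rcases v with v | v <;> simp [lift] at h
    · rcases v with v | v <;> simp [lift] at h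
    · rwa [lift_injective h]
  · intro h
    exact Or.inr (Or.inr ⟨v, rfl, h⟩)

/-- The partition `ᾱ` of `(X ∪ {x̄}) ∪ (X ∪ {x̄})'`: its blocks are the blocks of `α` that are not
points, and one more block consisting of `x̄`, `x̄'` and all points of `α`. -/
def bar {X : Type u} (α : Diagram X) : Diagram (Option X) where
  r p q := (Special α p ∧ Special α q) ∨ ∃ v w, p = lift v ∧ q = lift w ∧ α v w
  iseqv :=
    { refl := by
        rintro ((_ | x) | (_ | x))
        · exact Or.inl ⟨Or.inl rfl, Or.inl rfl⟩
        · exact Or.inr ⟨Sum.inl x, Sum.inl x, rfl, rfl, α.refl _⟩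
        · exact Or.inl ⟨Or.inr (Or.inl rfl), Or.inr (Or.inl rfl)⟩
        · exact Or.inr ⟨Sum.inr x, Sum.inr x, rfl, rfl, α.refl _⟩
      symm := by
        rintro p q (⟨h₁, h₂⟩ | ⟨v, w, h₁, h₂, h⟩)
        · exact Or.inl ⟨h₂, h₁⟩
        · exact Or.inr ⟨w, v, h₂, h₁, α.symm h⟩
      trans := by
        rintro p q r (⟨h₁, h₂⟩ | ⟨v, w, rfl, rfl, h⟩) (⟨h₃, h₄⟩ | ⟨v', w', h₃, rfl, h'⟩)
        · exact Or.inl ⟨h₁, h₄⟩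
        · subst h₃
          have hw : w' = v' := (class_eq α v').1 (special_lift.1 h₂) w' h'
          exact Or.inl ⟨h₁, by rwa [hw]⟩
        · have hv : v = w := (class_eq α w).1 (special_lift.1 h₃) v (α.symm h)
          exact Or.inl ⟨by rwa [hv], h₄⟩
        · obtain rfl := lift_injective h₃
          exact Or.inr ⟨v, w', rfl, rfl, α.trans h h'⟩ }

theorem bar_def {X : Type u} {α : Diagram X} {p q : Option X ⊕ Option X} :
    bar α p q ↔ (Special α p ∧ Special α q) ∨ ∃ v w, p = lift v ∧ q = lift w ∧ α v w := Iff.rfl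

/-- The inverse of `bar`: the block of `x̄` is broken into points. -/
def unbar {X : Type u} (γ : Diagram (Option X)) : Diagram X where
  r a b := a = b ∨ (γ (lift a) (lift b) ∧ ¬ γ (lift a) (Sum.inl none))
  iseqv :=
    { refl := fun a => Or.inl rfl
      symm := by
        rintro a b (rfl | ⟨h, h'⟩)
        · exact Or.inl rfl
        · exact Or.inr ⟨γ.symm h, fun h₁ => h' (γ.trans h h₁)⟩
      trans := by
        rintro a b c (rfl | ⟨h, h'⟩) (rfl | ⟨h₁, h₁'⟩)
        · exact Or.inl rfl
        · exact Or.inr ⟨h₁, h₁'⟩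
        · exact Or.inr ⟨h, h'⟩
        · exact Or.inr ⟨γ.trans h h₁, h'⟩ }

theorem unbar_def {X : Type u} {γ : Diagram (Option X)} {a b : X ⊕ X} :
    unbar γ a b ↔ a = b ∨ (γ (lift a) (lift b) ∧ ¬ γ (lift a) (Sum.inl none)) := Iff.rfl

/-- The image of the map `α ↦ ᾱ`: the elements of `I*_{X ∪ {x̄}}` with `x̄ ≡ x̄'`. -/
def InImage {X : Type u} (γ : Diagram (Option X)) : Prop :=
  IsDual γ ∧ γ (Sum.inl none) (Sum.inr none)

theorem inImage_bar {X : Type u} (α : PIStar X) : InImage (bar α.rel) := by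
  refine ⟨isDual_iff.2 ?_, Or.inl ⟨Or.inl rfl, Or.inr (Or.inl rfl)⟩⟩
  have key : ∀ v : X ⊕ X, (∃ x, bar α.rel (lift v) (Sum.inl x)) ∧
      ∃ y, bar α.rel (lift v) (Sum.inr y) := by
    intro v
    rcases blocks_iff.1 α.blocks v with h | ⟨⟨x, hx⟩, ⟨y, hy⟩⟩
    · exact ⟨⟨none, Or.inl ⟨special_lift.2 h, Or.inl rfl⟩⟩,
        ⟨none, Or.inl ⟨special_lift.2 h, Or.inr (Or.inl rfl)⟩⟩⟩
    · exact ⟨⟨some x, Or.inr ⟨v, Sum.inl x, rfl, rfl, hx⟩⟩,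
        ⟨some y, Or.inr ⟨v, Sum.inr y, rfl, rfl, hy⟩⟩⟩
  rintro ((_ | x) | (_ | x))
  · exact ⟨⟨none, Or.inl ⟨Or.inl rfl, Or.inl rfl⟩⟩, ⟨none, Or.inl ⟨Or.inl rfl, Or.inr (Or.inl rfl)⟩⟩⟩
  · exact key (Sum.inl x)
  · exact ⟨⟨none, Or.inl ⟨Or.inr (Or.inl rfl), Or.inl rfl⟩⟩,
      ⟨none, Or.inl ⟨Or.inr (Or.inl rfl), Or.inr (Or.inl rfl)⟩⟩⟩
  · exact key (Sum.inr x)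

theorem InImage.natMul {X : Type u} {γ δ : Diagram (Option X)} (hγ : InImage γ)
    (hδ : InImage δ) : InImage (natMul γ δ) :=
  ⟨hγ.1.natMul hδ.1, (stack γ δ).trans (stack_upper hγ.2) (stack_lower hδ.2)⟩

theorem unbar_partners {X : Type u} {γ : Diagram (Option X)} (hγ : InImage γ) {v : X ⊕ X}
    (hv : ¬ γ (lift v) (Sum.inl none)) :
    (∃ x, unbar γ v (Sum.inl x)) ∧ ∃ y, unbar γ v (Sum.inr y) := by
  obtain ⟨⟨x, hx⟩, ⟨y, hy⟩⟩ := isDual_iff.1 hγ.1 (lift v)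
  constructor
  · rcases x with _ | x
    · exact absurd hx hv
    · exact ⟨x, Or.inr ⟨hx, hv⟩⟩
  · rcases y with _ | y
    · exact absurd (γ.trans hy (γ.symm hγ.2)) hv
    · exact ⟨y, Or.inr ⟨hy, hv⟩⟩

theorem point_unbar {X : Type u} {γ : Diagram (Option X)} (hγ : InImage γ) (v : X ⊕ X) :
    {v} ∈ (unbar γ).classes ↔ γ (lift v) (Sum.inl none) := by
  rw [class_eq]
  constructor
  · intro h
    by_contra hv
    obtain ⟨⟨x, hx⟩, ⟨y, hy⟩⟩ := unbar_partners hγ hv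
    have := (h _ hx).trans (h _ hy).symm
    simp at this
  · rintro h w (rfl | ⟨-, h'⟩)
    · rfl
    · exact absurd h h'

/-- The element of `PI*_X` whose image under `α ↦ ᾱ` is `γ`. -/
def ofImage {X : Type u} (γ : Diagram (Option X)) (hγ : InImage γ) : PIStar X where
  rel := unbar γ
  blocks := by
    rw [blocks_iff]
    intro v
    by_cases hv : γ (lift v) (Sum.inl none)
    · exact Or.inl ((point_unbar hγ v).2 hv)
    · exact Or.inr (unbar_partners hγ hv)

theorem bar_unbar {X : Type u} {γ : Diagram (Option X)} (hγ : InImage γ) :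
    bar (unbar γ) = γ := by
  have hs : ∀ p, Special (unbar γ) p ↔ γ p (Sum.inl none) := by
    rintro ((_ | x) | (_ | x))
    · exact ⟨fun _ => γ.refl _, fun _ => Or.inl rfl⟩
    · exact (special_lift (v := Sum.inl x)).trans (point_unbar hγ _)
    · exact ⟨fun _ => γ.symm hγ.2, fun _ => Or.inr (Or.inl rfl)⟩
    · exact (special_lift (v := Sum.inr x)).trans (point_unbar hγ _)
  ext p q
  rw [bar_def, hs, hs]
  constructor
  · rintro (⟨h₁, h₂⟩ | ⟨v, w, rfl, rfl, rfl | ⟨h, -⟩⟩)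
    · exact γ.trans h₁ (γ.symm h₂)
    · exact γ.refl _
    · exact h
  · intro h
    by_cases hp : γ p (Sum.inl none)
    · exact Or.inl ⟨hp, γ.trans (γ.symm h) hp⟩
    · right
      have hq : ¬ γ q (Sum.inl none) := fun hq => hp (γ.trans h hq)
      have hlift : ∀ r, ¬ γ r (Sum.inl none) → ∃ v, r = lift v := by
        rintro ((_ | x) | (_ | x)) hr
        · exact absurd (γ.refl _) hr
        · exact ⟨Sum.inl x, rfl⟩
        · exact absurd (γ.symm hγ.2) hr
        · exact ⟨Sum.inr x, rfl⟩
      obtain ⟨v, rfl⟩ := hlift p hp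
      obtain ⟨w, rfl⟩ := hlift q hq
      exact ⟨v, w, rfl, rfl, Or.inr ⟨h, hp⟩⟩

theorem unbar_bar {X : Type u} (α : Diagram X) : unbar (bar α) = α := by
  ext a b
  rw [unbar_def, bar_def, bar_def, special_lift, special_lift]
  constructor
  · rintro (rfl | ⟨⟨h₁, -⟩ | ⟨v, w, hv, hw, h⟩, h'⟩)
    · exact α.refl _
    · exact absurd (Or.inl ⟨h₁, Or.inl rfl⟩) h'
    · rwa [lift_injective hv, lift_injective hw]
  · intro h
    by_cases ha : {a} ∈ α.classes
    · exact Or.inl ((class_eq α a).1 ha b h).symm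
    · refine Or.inr ⟨Or.inr ⟨a, b, rfl, rfl, h⟩, ?_⟩
      rintro (⟨h₁, -⟩ | ⟨v, w, -, hw, -⟩)
      · exact ha h₁
      · rcases w with w | w <;> simp [lift] at hw

theorem bar_injective {X : Type u} :
    Function.Injective fun α : PIStar X => bar α.rel := by
  intro α β h
  apply PIStar.ext
  rw [← unbar_bar α.rel, ← unbar_bar β.rel]
  exact congrArg unbar h

/-- The multiplication `⋆` of `PI*_X`: the element whose image under `α ↦ ᾱ` is the natural
product of the images of the factors. -/
instance {X : Type u} : Mul (PIStar X) where
  mul α β := ofImage (natMul (bar α.rel) (bar β.rel)) ((inImage_bar α).natMul (inImage_bar β))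

theorem bar_mul {X : Type u} (α β : PIStar X) :
    bar (α * β).rel = natMul (bar α.rel) (bar β.rel) :=
  bar_unbar ((inImage_bar α).natMul (inImage_bar β))

/-- The identity element: its blocks are the lines `{x, x'}`. -/
instance {X : Type u} : One (PIStar X) where
  one :=
    { rel := Setoid.ker (Sum.elim id id)
      blocks := by
        rw [blocks_iff]
        intro v
        exact Or.inr ⟨⟨Sum.elim id id v, rfl⟩, ⟨Sum.elim id id v, rfl⟩⟩ }

theorem bar_one {X : Type u} :
    bar (1 : PIStar X).rel = Setoid.ker (Sum.elim id id : Option X ⊕ Option X → Option X) := by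
  have h1 : ∀ v w : X ⊕ X, (1 : PIStar X).rel v w ↔
      (Sum.elim id id v : X) = Sum.elim id id w := fun _ _ => Iff.rfl
  have hp : ∀ v : X ⊕ X, {v} ∉ (1 : PIStar X).rel.classes := by
    intro v hv
    rw [class_eq] at hv
    have e₁ := hv (Sum.inl (Sum.elim id id v)) rfl
    have e₂ := hv (Sum.inr (Sum.elim id id v)) rfl
    have := e₁.trans e₂.symm
    simp at this
  have hs : ∀ p, Special (1 : PIStar X).rel p ↔
      (Sum.elim id id p : Option X) = none := by
    intro p
    constructor
    · rintro (rfl | rfl | ⟨v, -, hv⟩)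
      · rfl
      · rfl
      · exact absurd hv (hp v)
    · rcases p with (_ | x) | (_ | x) <;> simp [Special]
  have hl : ∀ v : X ⊕ X, (Sum.elim id id (lift v) : Option X) = some (Sum.elim id id v) := by
    rintro (x | x) <;> rfl
  ext p q
  rw [bar_def, hs, hs, Setoid.ker_def]
  constructor
  · rintro (⟨h₁, h₂⟩ | ⟨v, w, rfl, rfl, h⟩)
    · rw [h₁, h₂]
    · rw [hl, hl, (h1 v w).1 h]
  · intro h
    rcases hpn : (Sum.elim id id p : Option X) with _ | x
    · exact Or.inl ⟨rfl, by rw [← h, hpn]⟩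
    · right
      have hlift : ∀ r : Option X ⊕ Option X, (Sum.elim id id r : Option X) = some x →
          ∃ v : X ⊕ X, r = lift v ∧ (Sum.elim id id v : X) = x := by
        rintro (r | r) hr
        · exact ⟨Sum.inl x, by simpa [lift] using hr, rfl⟩
        · exact ⟨Sum.inr x, by simpa [lift] using hr, rfl⟩
      obtain ⟨v, rfl, hv⟩ := hlift p hpn
      obtain ⟨w, rfl, hw⟩ := hlift q (by rw [← h, hpn])
      exact ⟨v, w, rfl, rfl, (h1 v w).2 (hv.trans hw.symm)⟩

theorem natMul_ker {X : Type u} (α : Diagram X) :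
    natMul α (Setoid.ker (Sum.elim id id)) = α := by
  ext a b
  constructor
  · intro h
    rw [natMul_iff] at h
    let c : X ⊕ (X ⊕ X) → X ⊕ X := Sum.elim Sum.inl (fun v => Sum.inr (Sum.elim id id v))
    have c₁ : ∀ v : X ⊕ X, c (upper v) = v := by rintro (x | x) <;> rfl
    have c₂ : ∀ v : X ⊕ X, c (outer v) = v := by rintro (x | x) <;> rfl
    have := h (fun p => α a (c p))
    simp only [c₁, c₂] at this
    refine this (fun u v huv hu => α.trans hu huv) ?_ (α.refl a)
    intro u v huv hu
    have e : (Sum.elim id id u : X) = Sum.elim id id v := huv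
    have e' : c (lower u) = c (lower v) := congrArg Sum.inr e
    rwa [← e']
  · intro h
    have ho : ∀ v : X ⊕ X, stack α (Setoid.ker (Sum.elim id id)) (upper v) (outer v) := by
      rintro (x | x)
      · exact Setoid.refl' _ _
      · exact stack_lower (u := Sum.inl x) (v := Sum.inr x) rfl
    exact (stack α _).trans ((stack α _).symm (ho a)) ((stack α _).trans (stack_upper h) (ho b))

theorem ker_natMul {X : Type u} (α : Diagram X) :
    natMul (Setoid.ker (Sum.elim id id)) α = α := by
  have hk : reflect (Setoid.ker (Sum.elim id id : X ⊕ X → X)) = Setoid.ker (Sum.elim id id) := by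
    ext (a | a) (b | b) <;> exact Iff.rfl
  have := natMul_ker (reflect α)
  rw [← hk, ← reflect_natMul] at this
  rw [← reflect_reflect (natMul _ α), this, reflect_reflect]

instance {X : Type u} : Monoid (PIStar X) where
  mul_assoc α β γ := bar_injective (by
    simp only [bar_mul]
    exact natMul_assoc _ _ _)
  one_mul α := bar_injective (by
    simp only [bar_mul, bar_one]
    exact ker_natMul _)
  mul_one α := bar_injective (by
    simp only [bar_mul, bar_one]
    exact natMul_ker _)

/-- The rank: the number of generalised lines. -/
noncomputable def rank {X : Type u} (a : PIStar X) : ℕ :=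
  {B ∈ a.rel.classes | IsGeneralisedLine B}.ncard

/-- `I*_Y` as a subset of `PI*_X`, for `Y ⊆ X`: the elements whose points are exactly the `t` and
`t'` with `t ∉ Y`, so that the generalised lines form a partition of `Y ∪ Y'`. -/
def dualSymmetric {X : Type u} (Y : Set X) : Set (PIStar X) :=
  {a | ∀ v : X ⊕ X, {v} ∈ a.rel.classes ↔ Sum.elim id id v ∉ Y}

/-- The symmetric group `S_Y` as a subset of `PI*_X`: the elements of `I*_Y` all of whose
generalised lines are lines. -/
def symmetric {X : Type u} (Y : Set X) : Set (PIStar X) :=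
  {a ∈ dualSymmetric Y | ∀ B ∈ a.rel.classes, IsGeneralisedLine B → IsLine B}

end PIStar

/-- `G(e)`: the maximal subgroup with identity element `e`, i.e. the group of units of `eSe`. -/
def maximalSubgroup {S : Type u} [Semigroup S] (e : S) : Set S :=
  {a | e * a = a ∧ a * e = a ∧ ∃ b, e * b = b ∧ b * e = b ∧ a * b = e ∧ b * a = e}

/-- `T` is an isolated subsemigroup of `S`: a nonempty subset that is closed under multiplication
and contains every element some positive power of which it contains. -/
def IsIsolatedSubsemigroup {S : Type u} [Monoid S] (T : Set S) : Prop :=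
  T.Nonempty ∧ (∀ a ∈ T, ∀ b ∈ T, a * b ∈ T) ∧ ∀ (a : S) (k : ℕ), 1 ≤ k → a ^ k ∈ T → a ∈ T

end PartitionDiagram

namespace PartitionDiagram

open Set

universe u

namespace PIStar

variable {X : Type u}

/-! Under α ↦ ᾱ the elements become diagrams on X ∪ {x̄} in which x̄ and x̄' are joined; call the
block of x̄ (that is, of `none`) the zero block. Reflection makes PI*_X an inverse monoid. Its
idempotents are the `idem σ`, for σ a partition of X ∪ {x̄}; they multiply by joining partitions
(`idem_mul_idem`), and the maximal subgroup at `idem σ` consists of the elements inducing σ on both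
rows (`maximalSubgroup_idem`).

Let T be isolated and X finite. Every element has an idempotent power, so T contains the whole group
around each of its idempotents, is closed under `star`, and contains `idem a.top` and `idem a.bot`
for each of its elements a. The problem thus becomes one about the set of partitions σ with `idem σ
∈ T`. Two mechanisms govern this set. Upwards, it is closed under joins and has a greatest element
m, which is invariant under transpositions of nonzero blocks of any member e; hence m is ⊤, or it
has the zero block of e and either equals e or merges all other blocks (`greatest_trichotomy`).
Downwards, if a² lies in the group of a member ρ, then a ∈ T, and the possibly finer partition
`a.top` is a member as well (`idem_ker_mem`); in particular single vertices can be split off blocks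
(`idem_splitOff_mem`).

If ⊤ is a member, the descent reaches every atom of the partition lattice, hence every partition
except perhaps ⊥, and T is everything or everything but the units. Otherwise all members share one
zero block, containing at most one element of X (`exists_zeroClass`). With Y the complement of this
block, a minimal member other than `base Y` glues just two elements of Y (`exists_eq_glue`), and the
trichotomy leaves the four forms of `eq_of_zeroClass`.

Conversely, when at most one element lies outside Y, an element with a power in I*_Y is itself in
I*_Y (`mem_dualSymmetric_of_pow_mem`). The remaining sets are then isolated because partitions only
coarsen under multiplication. -/

/-! ### Diagrams as pairs of maps with a common image -/

theorem natMul_ker_elim {P Q R : Type*} {f g : P → Q} {f' g' : P → R} (hr : range f = range g)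
    (k : Q → R) (hk : f' = k ∘ g) :
    natMul (Setoid.ker (Sum.elim f g)) (Setoid.ker (Sum.elim f' g')) =
      Setoid.ker (Sum.elim (k ∘ f) g') := by
  subst hk
  -- A labelling of all three rows that is constant along both diagrams; on the outer rows it is the
  -- label of the claimed product.
  let c : P ⊕ (P ⊕ P) → R := Sum.elim (k ∘ f) (Sum.elim (k ∘ g) g')
  have c₁ : ∀ v, c (upper v) = k (Sum.elim f g v) := by rintro (x | x) <;> rfl
  have c₂ : ∀ v, c (lower v) = Sum.elim (k ∘ g) g' v := by rintro (x | x) <;> rfl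
  have c₃ : ∀ v, c (outer v) = Sum.elim (k ∘ f) g' v := by rintro (x | x) <;> rfl
  ext a b
  rw [Setoid.ker_def, ← c₃, ← c₃]
  constructor
  · intro h
    have h' := natMul_iff.1 h (fun p => c (outer a) = c p) ?_ ?_ rfl
    · exact h'
    · intro u v huv hu
      rw [hu, c₁, c₁, Setoid.ker_def.1 huv]
    · intro u v huv hu
      rw [hu, c₂, c₂, Setoid.ker_def.1 huv]
  · intro h
    have key : ∀ v : P ⊕ P, ∃ w : P ⊕ P,
        stack (Setoid.ker (Sum.elim f g)) (Setoid.ker (Sum.elim (k ∘ g) g')) (outer v) (lower w) ∧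
          c (outer v) = Sum.elim (k ∘ g) g' w := by
      rintro (x | x)
      · obtain ⟨z, hz⟩ : f x ∈ range g := hr ▸ mem_range_self x
        exact ⟨Sum.inl z, stack_upper (u := Sum.inl x) (v := Sum.inr z) hz.symm,
          (congrArg k hz).symm⟩
      · exact ⟨Sum.inr x, Setoid.refl' _ _, rfl⟩
    obtain ⟨w, hw, hw'⟩ := key a
    obtain ⟨z, hz, hz'⟩ := key b
    exact (stack _ _).trans hw ((stack _ _).trans
      (stack_lower (hw'.symm.trans (h.trans hz'))) ((stack _ _).symm hz))

theorem bar_ofImage {γ : Diagram (Option X)} (hγ : InImage γ) : bar (ofImage γ hγ).rel = γ :=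
  bar_unbar hγ

theorem inImage_ker {Q : Type*} {f g : Option X → Q} (hr : range f = range g)
    (h0 : f none = g none) : InImage (Setoid.ker (Sum.elim f g)) := by
  refine ⟨isDual_iff.2 ?_, h0⟩
  rintro (x | x)
  · obtain ⟨z, hz⟩ : f x ∈ range g := hr ▸ mem_range_self x
    exact ⟨⟨x, rfl⟩, ⟨z, hz.symm⟩⟩
  · obtain ⟨z, hz⟩ : g x ∈ range f := hr ▸ mem_range_self x
    exact ⟨⟨z, hz.symm⟩, ⟨x, rfl⟩⟩

/-- The element given by two maps with the same image: the vertices `x` and `y'` of its image under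
`bar` are related if and only if `f x = g y`. -/
def ofMaps {Q : Type*} (f g : Option X → Q) (hr : range f = range g) (h0 : f none = g none) :
    PIStar X :=
  ofImage (Setoid.ker (Sum.elim f g)) (inImage_ker hr h0)

theorem bar_ofMaps {Q : Type*} {f g : Option X → Q} (hr : range f = range g)
    (h0 : f none = g none) : bar (ofMaps f g hr h0).rel = Setoid.ker (Sum.elim f g) :=
  bar_ofImage _

theorem eq_of_bar {a b : PIStar X} (h : bar a.rel = bar b.rel) : a = b := bar_injective h

theorem exists_eq_ofMaps (a : PIStar X) : ∃ (Q : Type u) (f g : Option X → Q)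
    (hr : range f = range g) (h0 : f none = g none), a = ofMaps f g hr h0 := by
  obtain ⟨hd, h0⟩ := inImage_bar a
  have hd' := isDual_iff.1 hd
  have hr : range (fun x => (Quotient.mk (bar a.rel) (Sum.inl x))) =
      range (fun x => (Quotient.mk (bar a.rel) (Sum.inr x))) := by
    ext q
    constructor
    · rintro ⟨x, rfl⟩
      obtain ⟨y, hy⟩ := (hd' (Sum.inl x)).2
      exact ⟨y, Quotient.sound ((bar a.rel).symm hy)⟩
    · rintro ⟨x, rfl⟩
      obtain ⟨y, hy⟩ := (hd' (Sum.inr x)).1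
      exact ⟨y, Quotient.sound ((bar a.rel).symm hy)⟩
  refine ⟨Quotient (bar a.rel), _, _, hr, Quotient.sound h0, eq_of_bar ?_⟩
  rw [bar_ofMaps]
  ext p q
  rw [Setoid.ker_def]
  have : ∀ p : Option X ⊕ Option X, Sum.elim (fun x => (Quotient.mk (bar a.rel) (Sum.inl x)))
      (fun x => (Quotient.mk (bar a.rel) (Sum.inr x))) p = Quotient.mk (bar a.rel) p := by
    rintro (x | x) <;> rfl
  rw [this, this]
  exact Quotient.eq.symm

theorem ofMaps_mul {Q R : Type*} {f g : Option X → Q} {f' g' : Option X → R}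
    (hr : range f = range g) (h0 : f none = g none) (hr' : range f' = range g')
    (h0' : f' none = g' none) (k : Q → R) (hk : f' = k ∘ g) :
    ofMaps f g hr h0 * ofMaps f' g' hr' h0' = ofMaps (k ∘ f) g'
      (by rw [← hr', hk, range_comp, range_comp, hr])
      (by rw [← h0', hk]; exact congrArg k h0) := by
  apply eq_of_bar
  rw [bar_mul, bar_ofMaps, bar_ofMaps, bar_ofMaps, natMul_ker_elim hr k hk]

theorem reflect_ker_elim {P Q : Type*} (f g : P → Q) :
    reflect (Setoid.ker (Sum.elim f g)) = Setoid.ker (Sum.elim g f) := by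
  ext (x | x) (y | y) <;> exact Iff.rfl

theorem inImage_reflect {γ : Diagram (Option X)} (hγ : InImage γ) : InImage (reflect γ) := by
  refine ⟨isDual_iff.2 fun v => ?_, γ.symm hγ.2⟩
  obtain ⟨h₁, h₂⟩ := isDual_iff.1 hγ.1 v.swap
  exact ⟨h₂, h₁⟩

/-! ### Reflection, idempotents and the inverse monoid structure -/

instance : Star (PIStar X) where
  star a := ofImage (reflect (bar a.rel)) (inImage_reflect (inImage_bar a))

theorem bar_star (a : PIStar X) : bar (star a).rel = reflect (bar a.rel) := bar_ofImage _

theorem star_ofMaps {Q : Type*} {f g : Option X → Q} (hr : range f = range g)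
    (h0 : f none = g none) : star (ofMaps f g hr h0) = ofMaps g f hr.symm h0.symm := by
  apply eq_of_bar
  rw [bar_star, bar_ofMaps, bar_ofMaps, reflect_ker_elim]

instance : StarMul (PIStar X) where
  star_involutive a := eq_of_bar (by rw [bar_star, bar_star, reflect_reflect])
  star_mul a b := eq_of_bar (by
    rw [bar_star, bar_mul, bar_mul, bar_star, bar_star, reflect_natMul])

/-- The partition of `X ∪ {x̄}` induced by the top row. -/
def top (a : PIStar X) : Setoid (Option X) := (bar a.rel).comap Sum.inl

/-- The partition of `X ∪ {x̄}` induced by the bottom row. -/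
def bot (a : PIStar X) : Setoid (Option X) := (bar a.rel).comap Sum.inr

theorem top_rel {a : PIStar X} {p q : Option X} :
    a.top p q ↔ bar a.rel (Sum.inl p) (Sum.inl q) := Iff.rfl

theorem bot_rel {a : PIStar X} {p q : Option X} :
    a.bot p q ↔ bar a.rel (Sum.inr p) (Sum.inr q) := Iff.rfl

theorem top_star (a : PIStar X) : (star a).top = a.bot := by
  ext p q
  rw [top_rel, bar_star]
  exact Iff.rfl

theorem bot_star (a : PIStar X) : (star a).bot = a.top := by
  rw [← top_star, star_star]

theorem top_ofMaps {Q : Type*} {f g : Option X → Q} (hr : range f = range g)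
    (h0 : f none = g none) : (ofMaps f g hr h0).top = Setoid.ker f := by
  ext p q
  rw [top_rel, bar_ofMaps]
  exact Iff.rfl

theorem bot_ofMaps {Q : Type*} {f g : Option X → Q} (hr : range f = range g)
    (h0 : f none = g none) : (ofMaps f g hr h0).bot = Setoid.ker g := by
  rw [← top_star, star_ofMaps, top_ofMaps]

/-- The idempotent given by a partition of `X ∪ {x̄}`. -/
def idem (σ : Setoid (Option X)) : PIStar X :=
  ofMaps (Quotient.mk σ) (Quotient.mk σ) rfl rfl

theorem bar_idem (σ : Setoid (Option X)) :
    bar (idem σ).rel = σ.comap (Sum.elim id id) := by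
  rw [idem, bar_ofMaps]
  ext (x | x) (y | y) <;> exact Quotient.eq

theorem ofMaps_self {Q : Type*} (f : Option X → Q) : ofMaps f f rfl rfl = idem (Setoid.ker f) := by
  apply eq_of_bar
  rw [bar_ofMaps, bar_idem]
  ext (x | x) (y | y) <;> exact Iff.rfl

theorem top_idem (σ : Setoid (Option X)) : (idem σ).top = σ := by
  rw [idem, top_ofMaps]
  ext x y
  exact Quotient.eq

theorem bot_idem (σ : Setoid (Option X)) : (idem σ).bot = σ := by
  rw [idem, bot_ofMaps]
  ext x y
  exact Quotient.eq

theorem idem_injective : Function.Injective (idem (X := X)) :=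
  Function.LeftInverse.injective top_idem

theorem star_idem (σ : Setoid (Option X)) : star (idem σ) = idem σ := star_ofMaps _ _

theorem mul_star_self_eq (a : PIStar X) : a * star a = idem a.top := by
  obtain ⟨Q, f, g, hr, h0, rfl⟩ := exists_eq_ofMaps a
  rw [star_ofMaps, ofMaps_mul _ _ _ _ id (Function.id_comp _).symm, top_ofMaps, ← ofMaps_self]
  rfl

theorem star_mul_self_eq (a : PIStar X) : star a * a = idem a.bot := by
  rw [← top_star, ← mul_star_self_eq, star_star]

theorem idem_top_mul (a : PIStar X) : idem a.top * a = a := by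
  obtain ⟨Q, f, g, hr, h0, rfl⟩ := exists_eq_ofMaps a
  rw [top_ofMaps, ← ofMaps_self, ofMaps_mul _ _ _ _ id (Function.id_comp _).symm]
  rfl

theorem mul_idem_bot (a : PIStar X) : a * idem a.bot = a := by
  have := congrArg star (idem_top_mul (star a))
  rwa [star_mul, star_star, star_idem, top_star] at this

/-- Forgetting the row of a vertex maps the stacked diagram to X ∪ {x̄}, where its connections
generate exactly the join. -/
theorem idem_mul_idem (σ τ : Setoid (Option X)) : idem σ * idem τ = idem (σ ⊔ τ) := by
  apply eq_of_bar
  rw [bar_mul]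
  simp only [bar_idem]
  let c : Option X ⊕ (Option X ⊕ Option X) → Option X := Sum.elim id (Sum.elim id id)
  have c₁ : ∀ v, c (upper v) = Sum.elim id id v := by rintro (x | x) <;> rfl
  have c₂ : ∀ v, c (lower v) = Sum.elim id id v := by rintro (x | x) <;> rfl
  have c₃ : ∀ v, c (outer v) = Sum.elim id id v := by rintro (x | x) <;> rfl
  ext a b
  constructor
  · intro h
    have h' := natMul_iff.1 h (fun p => (σ ⊔ τ) (c (outer a)) (c p)) ?_ ?_ (Setoid.refl' _ _)
    · rwa [c₃, c₃] at h'
    · intro u v huv hu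
      rw [c₁] at hu ⊢
      exact (σ ⊔ τ).trans hu ((le_sup_left : σ ≤ σ ⊔ τ) huv)
    · intro u v huv hu
      rw [c₂] at hu ⊢
      exact (σ ⊔ τ).trans hu ((le_sup_right : τ ≤ σ ⊔ τ) huv)
  · intro h
    set s := stack (σ.comap (Sum.elim id id)) (τ.comap (Sum.elim id id)) with hs
    have hσ : σ ≤ s.comap (fun x => Sum.inr (Sum.inl x)) := fun {x y} hxy =>
      stack_upper (u := Sum.inr x) (v := Sum.inr y) hxy
    have hτ : τ ≤ s.comap (fun x => Sum.inr (Sum.inl x)) := fun {x y} hxy =>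
      stack_lower (u := Sum.inl x) (v := Sum.inl y) hxy
    have key : ∀ v, s (outer v) (Sum.inr (Sum.inl (Sum.elim id id v))) := by
      rintro (x | x)
      · exact stack_upper (u := Sum.inl x) (v := Sum.inr x) (σ.refl _)
      · exact stack_lower (u := Sum.inr x) (v := Sum.inl x) (τ.refl _)
    exact s.trans (key a) (s.trans (sup_le hσ hτ h) (s.symm (key b)))

/-- From e * e = e one gets (star e * e) * (e * star e) = star e, so `star e` is a product of two
`idem`s. -/
theorem eq_idem_of_isIdempotentElem {e : PIStar X} (he : e * e = e) : ∃ σ, e = idem σ := by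
  have h : star e = idem (e.bot ⊔ e.top) := by
    rw [← idem_mul_idem, ← star_mul_self_eq, ← mul_star_self_eq, mul_assoc, ← mul_assoc e e, he,
      mul_star_self_eq, ← bot_star, mul_idem_bot]
  exact ⟨_, by rw [← star_star e, h, star_idem]⟩

theorem top_le_top_mul (a b : PIStar X) : a.top ≤ (a * b).top := by
  intro p q h
  rw [top_rel, bar_mul]
  exact stack_upper (u := Sum.inl p) (v := Sum.inl q) h

theorem bot_le_bot_mul (a b : PIStar X) : b.bot ≤ (a * b).bot := by
  intro p q h
  rw [bot_rel, bar_mul]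
  exact stack_lower (u := Sum.inr p) (v := Sum.inr q) h

theorem top_le_top_pow (a : PIStar X) {k : ℕ} (hk : 1 ≤ k) : a.top ≤ (a ^ k).top := by
  obtain ⟨k, rfl⟩ := Nat.exists_eq_add_of_le' hk
  rw [pow_succ']
  exact top_le_top_mul _ _

theorem bot_le_bot_pow (a : PIStar X) {k : ℕ} (hk : 1 ≤ k) : a.bot ≤ (a ^ k).bot := by
  obtain ⟨k, rfl⟩ := Nat.exists_eq_add_of_le' hk
  rw [pow_succ]
  exact bot_le_bot_mul _ _

/-! ### Maximal subgroups and idempotent powers -/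

/-- The elements that induce the partition `σ` on both rows. -/
def groupClass (σ : Setoid (Option X)) : Set (PIStar X) := {a | a.top = σ ∧ a.bot = σ}

theorem idem_mem_groupClass (σ : Setoid (Option X)) : idem σ ∈ groupClass σ :=
  ⟨top_idem σ, bot_idem σ⟩

/-- The hypothesis makes `idem b.top` a right identity for a, so (ab)(ab)* reduces to aa*. -/
theorem top_mul_of_le {a b : PIStar X} (h : b.top ≤ a.bot) : (a * b).top = a.top := by
  apply idem_injective
  have ha : a * idem b.top = a := by
    conv_lhs => rw [← mul_idem_bot a]
    rw [mul_assoc, idem_mul_idem, sup_eq_left.2 h, mul_idem_bot]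
  rw [← mul_star_self_eq, star_mul, mul_assoc, ← mul_assoc b, mul_star_self_eq, ← mul_assoc, ha,
    mul_star_self_eq]

theorem bot_mul_of_le {a b : PIStar X} (h : a.bot ≤ b.top) : (a * b).bot = b.bot := by
  rw [← top_star, star_mul, top_mul_of_le, top_star]
  rwa [top_star, bot_star]

theorem groupClass_mul {σ : Setoid (Option X)} {a b : PIStar X} (ha : a ∈ groupClass σ)
    (hb : b ∈ groupClass σ) : a * b ∈ groupClass σ :=
  ⟨(top_mul_of_le (hb.1.trans ha.2.symm).le).trans ha.1,
    (bot_mul_of_le (ha.2.trans hb.1.symm).le).trans hb.2⟩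

theorem groupClass_pow {σ : Setoid (Option X)} {a : PIStar X} (ha : a ∈ groupClass σ) {k : ℕ}
    (hk : 1 ≤ k) : a ^ k ∈ groupClass σ := by
  induction k, hk using Nat.le_induction with
  | base => rwa [pow_one]
  | succ k _ ih =>
    rw [pow_succ]
    exact groupClass_mul ih ha

theorem idem_mem_groupClass_iff {σ τ : Setoid (Option X)} : idem σ ∈ groupClass τ ↔ σ = τ :=
  ⟨fun h => (top_idem σ).symm.trans h.1, fun h => h ▸ idem_mem_groupClass σ⟩

theorem maximalSubgroup_idem (σ : Setoid (Option X)) :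
    maximalSubgroup (idem σ) = groupClass σ := by
  ext a
  constructor
  · rintro ⟨h₁, h₂, b, -, -, hab, hba⟩
    constructor
    · apply le_antisymm
      · rw [← top_idem σ, ← hab]
        exact top_le_top_mul _ _
      · rw [← h₁]
        exact (top_idem σ).ge.trans (top_le_top_mul _ _)
    · apply le_antisymm
      · rw [← bot_idem σ, ← hba]
        exact bot_le_bot_mul _ _
      · rw [← h₂]
        exact (bot_idem σ).ge.trans (bot_le_bot_mul _ _)
  · rintro ⟨rfl, h⟩
    refine ⟨idem_top_mul a, ?_, star a, ?_, ?_, mul_star_self_eq a, ?_⟩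
    · rw [← h, mul_idem_bot]
    · rw [← h, ← top_star, idem_top_mul]
    · rw [← bot_star, mul_idem_bot]
    · rw [star_mul_self_eq, h]

instance [Finite X] : Finite (PIStar X) :=
  Finite.of_injective (fun a : PIStar X => fun v w => a.rel v w) fun _ _ h =>
    PIStar.ext (Setoid.ext fun v w => iff_of_eq (congrFun (congrFun h v) w))

theorem exists_pow_eq_idem [Finite X] (a : PIStar X) :
    ∃ k, 1 ≤ k ∧ ∃ σ, a ^ k = idem σ := by
  obtain ⟨i, j, hij, h⟩ : ∃ i j : ℕ, i < j ∧ a ^ i = a ^ j := by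
    obtain ⟨i, j, hne, h⟩ := Finite.exists_ne_map_eq_of_infinite fun k : ℕ => a ^ k
    rcases hne.lt_or_gt with hlt | hlt
    · exact ⟨i, j, hlt, h⟩
    · exact ⟨j, i, hlt, h.symm⟩
  obtain ⟨p, rfl⟩ := Nat.exists_eq_add_of_lt hij
  have step : ∀ m, i ≤ m → ∀ r : ℕ, a ^ (m + r * (p + 1)) = a ^ m := by
    intro m hm r
    induction r with
    | zero => simp
    | succ r ih =>
      obtain ⟨d, rfl⟩ := Nat.exists_eq_add_of_le hm
      rw [← ih, show i + d + (r + 1) * (p + 1) = (i + p + 1) + (d + r * (p + 1)) by ring, pow_add,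
        ← h, ← pow_add, add_assoc]
  have hm : i ≤ (i + 1) * (p + 1) := by nlinarith
  -- The exponent is a multiple of the period p + 1 and at least i, so doubling it does not change
  -- the power.
  refine ⟨(i + 1) * (p + 1), by nlinarith, eq_idem_of_isIdempotentElem ?_⟩
  rw [← pow_add, step _ hm]

theorem natCard_quotient_top (a : PIStar X) :
    Nat.card (Quotient a.top) = Nat.card (Quotient a.bot) := by
  obtain ⟨Q, f, g, hr, h0, rfl⟩ := exists_eq_ofMaps a
  rw [top_ofMaps, bot_ofMaps, Nat.card_congr (Setoid.quotientKerEquivRange f),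
    Nat.card_congr (Setoid.quotientKerEquivRange g), hr]

/-! ### Points, the zero block and the rank -/

theorem point_iff {a : PIStar X} {v : X ⊕ X} :
    {v} ∈ a.rel.classes ↔ bar a.rel (lift v) (Sum.inl none) := by
  have := point_unbar (inImage_bar a) v
  rwa [unbar_bar] at this

theorem rel_iff {a : PIStar X} {v w : X ⊕ X} : a.rel v w ↔
    v = w ∨ (bar a.rel (lift v) (lift w) ∧ ¬ bar a.rel (lift v) (Sum.inl none)) := by
  conv_lhs => rw [← unbar_bar a.rel]
  exact unbar_def

theorem point_inl_iff {a : PIStar X} {x : X} :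
    {Sum.inl x} ∈ a.rel.classes ↔ a.top (some x) none := point_iff

theorem point_inr_iff {a : PIStar X} {x : X} :
    {Sum.inr x} ∈ a.rel.classes ↔ a.bot (some x) none := by
  have h := (inImage_bar a).2
  exact point_iff.trans ⟨fun h' => (bar a.rel).trans h' h,
    fun h' => (bar a.rel).trans h' ((bar a.rel).symm h)⟩

theorem rel_inl_iff {a : PIStar X} {x y : X} (hx : ¬ a.top (some x) none) :
    a.rel (Sum.inl x) (Sum.inl y) ↔ a.top (some x) (some y) := by
  rw [rel_iff]
  constructor
  · rintro (h | h)
    · rw [Sum.inl_injective h]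
    · exact h.1
  · exact fun h => Or.inr ⟨h, hx⟩

theorem rel_inr_iff {a : PIStar X} {x y : X} (hx : ¬ a.bot (some x) none) :
    a.rel (Sum.inr x) (Sum.inr y) ↔ a.bot (some x) (some y) := by
  rw [rel_iff]
  constructor
  · rintro (h | h)
    · rw [Sum.inr_injective h]
    · exact h.1
  · exact fun h => Or.inr ⟨h, fun h' => hx ((bar a.rel).trans h' (inImage_bar a).2)⟩

/-- The block of `x̄` in `σ` consists of `x̄` and the elements outside `Y`. -/
def ZeroClass (Y : Set X) (σ : Setoid (Option X)) : Prop := ∀ x, σ (some x) none ↔ x ∉ Y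

theorem mem_dualSymmetric_iff {Y : Set X} {a : PIStar X} :
    a ∈ dualSymmetric Y ↔ ZeroClass Y a.top ∧ ZeroClass Y a.bot := by
  constructor
  · intro h
    exact ⟨fun x => point_inl_iff.symm.trans (h (Sum.inl x)),
      fun x => point_inr_iff.symm.trans (h (Sum.inr x))⟩
  · rintro ⟨h₁, h₂⟩ (x | x)
    · exact point_inl_iff.trans (h₁ x)
    · exact point_inr_iff.trans (h₂ x)

theorem idem_mem_dualSymmetric_iff {Y : Set X} {σ : Setoid (Option X)} :
    idem σ ∈ dualSymmetric Y ↔ ZeroClass Y σ := by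
  rw [mem_dualSymmetric_iff, top_idem, bot_idem, and_self]

open Classical in
/-- The map that sends `x̄` and the elements outside `Y` to `x̄` and fixes the elements of `Y`. -/
noncomputable def collapse (Y : Set X) : Option X → Option X
  | none => none
  | some x => if x ∈ Y then some x else none

/-- The finest partition in which `x̄` and the elements outside `Y` form a block. -/
noncomputable def base (Y : Set X) : Setoid (Option X) := Setoid.ker (collapse Y)

theorem collapse_some {Y : Set X} {x : X} (hx : x ∈ Y) : collapse Y (some x) = some x :=
  if_pos hx

theorem collapse_some_of_notMem {Y : Set X} {x : X} (hx : x ∉ Y) :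
    collapse Y (some x) = none := if_neg hx

theorem base_rel {Y : Set X} {p q : Option X} :
    base Y p q ↔ collapse Y p = collapse Y q := Iff.rfl

theorem zeroClass_base (Y : Set X) : ZeroClass Y (base Y) := by
  intro x
  rw [base_rel]
  by_cases hx : x ∈ Y
  · simp [hx, collapse]
  · simp [hx, collapse]

theorem ker_le_of {P : Type*} {σ : Setoid P} {h : P → P} (hh : ∀ p, σ p (h p)) :
    Setoid.ker h ≤ σ := by
  intro p q hpq
  have := hh q
  rw [← Setoid.ker_def.1 hpq] at this
  exact σ.trans (hh p) (σ.symm this)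

theorem base_le_iff {Y : Set X} {σ : Setoid (Option X)} :
    base Y ≤ σ ↔ ∀ x ∉ Y, σ (some x) none := by
  refine ⟨fun h x hx => h ((zeroClass_base Y x).2 hx), fun h => ker_le_of ?_⟩
  rintro (_ | x)
  · exact σ.refl _
  · by_cases hx : x ∈ Y
    · rw [collapse_some hx]
    · rw [collapse_some_of_notMem hx]
      exact h x hx

theorem ZeroClass.base_le {Y : Set X} {σ : Setoid (Option X)} (h : ZeroClass Y σ) :
    base Y ≤ σ :=
  base_le_iff.2 fun x hx => (h x).2 hx

theorem le_base_of {Y : Set X} {σ : Setoid (Option X)} (h : ZeroClass Y σ)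
    (h' : ∀ x ∈ Y, ∀ y ∈ Y, σ (some x) (some y) → x = y) : σ ≤ base Y := by
  have key : ∀ p, ¬ σ p none → ∃ x ∈ Y, p = some x := by
    rintro (_ | x) hp
    · exact absurd (σ.refl _) hp
    · exact ⟨x, not_not.1 fun hx => hp ((h x).2 hx), rfl⟩
  have key' : ∀ p, σ p none → collapse Y p = none := by
    rintro (_ | x) hp
    · rfl
    · exact collapse_some_of_notMem ((h x).1 hp)
  intro p q hpq
  rw [base_rel]
  by_cases hp : σ p none
  · rw [key' p hp, key' q (σ.trans (σ.symm hpq) hp)]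
  · obtain ⟨x, hx, rfl⟩ := key p hp
    obtain ⟨y, hy, rfl⟩ := key q fun hq => hp (σ.trans hpq hq)
    rw [h' x hx y hy hpq]

theorem eq_of_base_rel {Y : Set X} {x : X} {q : Option X} (hx : x ∈ Y)
    (h : base Y (some x) q) : q = some x := by
  rw [base_rel, collapse_some hx] at h
  rcases q with _ | y
  · simp [collapse] at h
  · by_cases hy : y ∈ Y
    · rw [collapse_some hy] at h
      exact h.symm
    · rw [collapse_some_of_notMem hy] at h
      simp at h

/-- A generalised line is a line exactly when it has one vertex in each row, and `base Y` is the
partition with its prescribed zero block and singletons elsewhere. -/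
theorem symmetric_eq (Y : Set X) : symmetric Y = groupClass (base Y) := by
  have hline : ∀ {B : Set (X ⊕ X)}, IsLine B → ∀ {u v w}, u ∈ B → v ∈ B → w ∈ B →
      u ≠ v → u ≠ w → v = w := by
    intro B hB u v w hu hv hw huv huw
    obtain ⟨s, t, hst, rfl⟩ := Set.ncard_eq_two.1 hB.2
    simp only [mem_insert_iff, mem_singleton_iff] at hu hv hw
    grind
  ext a
  constructor
  · rintro ⟨ha, hl⟩
    obtain ⟨h₁, h₂⟩ := mem_dualSymmetric_iff.1 ha
    constructor
    · refine le_antisymm (le_base_of h₁ fun x hx y hy hxy => ?_) h₁.base_le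
      have hx' : ¬ a.top (some x) none := fun h => (h₁ x).1 h hx
      rcases blocks_iff.1 a.blocks (Sum.inl x) with h | ⟨-, z, hz⟩
      · exact absurd (point_inl_iff.1 h) hx'
      · have := hline (hl _ (a.rel.mem_classes (Sum.inl x))
          ⟨⟨x, a.rel.refl _⟩, ⟨z, a.rel.symm hz⟩⟩) (u := Sum.inr z) (v := Sum.inl x)
          (w := Sum.inl y) (a.rel.symm hz) (a.rel.refl _)
          (a.rel.symm ((rel_inl_iff hx').2 hxy)) (by simp) (by simp)
        exact Sum.inl_injective this
    · refine le_antisymm (le_base_of h₂ fun x hx y hy hxy => ?_) h₂.base_le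
      have hx' : ¬ a.bot (some x) none := fun h => (h₂ x).1 h hx
      rcases blocks_iff.1 a.blocks (Sum.inr x) with h | ⟨⟨z, hz⟩, -⟩
      · exact absurd (point_inr_iff.1 h) hx'
      · have := hline (hl _ (a.rel.mem_classes (Sum.inr x))
          ⟨⟨z, a.rel.symm hz⟩, ⟨x, a.rel.refl _⟩⟩) (u := Sum.inl z) (v := Sum.inr x)
          (w := Sum.inr y) (a.rel.symm hz) (a.rel.refl _)
          (a.rel.symm ((rel_inr_iff hx').2 hxy)) (by simp) (by simp)
        exact Sum.inr_injective this
  · rintro ⟨h₁, h₂⟩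
    have ha : a ∈ dualSymmetric Y := by
      rw [mem_dualSymmetric_iff, h₁, h₂, and_self]
      exact zeroClass_base Y
    refine ⟨ha, ?_⟩
    rintro B ⟨v, rfl⟩ ⟨⟨x, hx⟩, ⟨y, hy⟩⟩
    refine ⟨⟨⟨x, hx⟩, ⟨y, hy⟩⟩, Set.ncard_eq_two.2 ⟨Sum.inl x, Sum.inr y, by simp, ?_⟩⟩
    have hxy : a.rel (Sum.inl x) (Sum.inr y) := a.rel.trans hx (a.rel.symm hy)
    have hx' : ¬ a.top (some x) none := fun h => by
      simpa using (class_eq _ _).1 (point_inl_iff.2 h) _ hxy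
    have hy' : ¬ a.bot (some y) none := fun h => by
      simpa using (class_eq _ _).1 (point_inr_iff.2 h) _ (a.rel.symm hxy)
    have hxY : x ∈ Y := by
      rw [h₁] at hx'
      exact not_not.1 fun h => hx' ((zeroClass_base Y x).2 h)
    have hyY : y ∈ Y := by
      rw [h₂] at hy'
      exact not_not.1 fun h => hy' ((zeroClass_base Y y).2 h)
    ext (z | z)
    · simp only [mem_ofPred_eq, mem_insert_iff, mem_singleton_iff, Sum.inl.injEq, reduceCtorEq,
        or_false]
      constructor
      · intro hz
        have := (rel_inl_iff hx').1 (a.rel.trans hx (a.rel.symm hz))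
        rw [h₁] at this
        exact Option.some_injective _ (eq_of_base_rel hxY this)
      · rintro rfl
        exact hx
    · simp only [mem_ofPred_eq, mem_insert_iff, mem_singleton_iff, Sum.inr.injEq, reduceCtorEq,
        false_or]
      constructor
      · intro hz
        have := (rel_inr_iff hy').1 (a.rel.trans hy (a.rel.symm hz))
        rw [h₂] at this
        exact Option.some_injective _ (eq_of_base_rel hyY this)
      · rintro rfl
        exact hy

theorem ncard_image_eq_of_iff {α β γ : Type*} {S : Set α} {f : α → β} {g : α → γ}
    (h : ∀ x ∈ S, ∀ y ∈ S, f x = f y ↔ g x = g y) : (f '' S).ncard = (g '' S).ncard := by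
  have hk : Setoid.ker (f ∘ ((↑) : S → α)) = Setoid.ker (g ∘ ((↑) : S → α)) :=
    Setoid.ext fun x y => h x x.2 y y.2
  have hS : S = range ((↑) : S → α) := Subtype.range_coe.symm
  conv_lhs => rw [hS, ← range_comp]
  conv_rhs => rw [hS, ← range_comp]
  rw [← Nat.card_coe_set_eq, ← Nat.card_coe_set_eq,
    ← Nat.card_congr (Setoid.quotientKerEquivRange _), hk,
    Nat.card_congr (Setoid.quotientKerEquivRange _)]

/-- Generalised lines correspond to the nonzero blocks of the top row; the zero block accounts for
the extra one. -/
theorem rank_add_one [Finite X] (a : PIStar X) : a.rank + 1 = Nat.card (Quotient a.top) := by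
  have hL : {B ∈ a.rel.classes | IsGeneralisedLine B} =
      (fun x => {w | a.rel w (Sum.inl x)}) '' {x | ¬ a.top (some x) none} := by
    ext B
    constructor
    · rintro ⟨⟨v, rfl⟩, ⟨x, hx⟩, ⟨y, hy⟩⟩
      refine ⟨x, fun h => ?_, ?_⟩
      · simpa using (class_eq _ _).1 (point_inl_iff.2 h) _ (a.rel.trans hx (a.rel.symm hy))
      · ext w
        exact ⟨fun hw => a.rel.trans hw hx, fun hw => a.rel.trans hw (a.rel.symm hx)⟩
    · rintro ⟨x, hx, rfl⟩
      refine ⟨a.rel.mem_classes _, ⟨x, a.rel.refl _⟩, ?_⟩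
      rcases blocks_iff.1 a.blocks (Sum.inl x) with h | ⟨-, z, hz⟩
      · exact absurd (point_inl_iff.1 h) hx
      · exact ⟨z, a.rel.symm hz⟩
  have hQ : {Quotient.mk a.top none}ᶜ =
      (fun x => Quotient.mk a.top (some x)) '' {x | ¬ a.top (some x) none} := by
    ext q
    constructor
    · intro hq
      obtain ⟨(_ | x), rfl⟩ := Quotient.exists_rep q
      · exact absurd rfl hq
      · exact ⟨x, fun h => hq (Quotient.sound h), rfl⟩
    · rintro ⟨x, hx, rfl⟩ h
      exact hx (Quotient.exact h)
  have hcard : a.rank = ({Quotient.mk a.top none}ᶜ : Set _).ncard := by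
    rw [rank, hL, hQ]
    refine ncard_image_eq_of_iff fun x hx y hy => ?_
    rw [Quotient.eq (r := a.top)]
    refine Iff.trans ⟨fun h => ?_, fun h => ?_⟩ (rel_inl_iff hx)
    · have h' : Sum.inl x ∈ {w | a.rel w (Sum.inl x)} := a.rel.refl _
      rwa [h] at h'
    · ext w
      exact ⟨fun hw => a.rel.trans hw h, fun hw => a.rel.trans hw (a.rel.symm h)⟩
  rw [hcard, ← Set.ncard_singleton (Quotient.mk a.top none), add_comm, Set.ncard_add_ncard_compl]

theorem natCard_quotient_lt [Finite X] {σ τ : Setoid (Option X)} (h : σ < τ) :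
    Nat.card (Quotient τ) < Nat.card (Quotient σ) := by
  have hs : Function.Surjective (Quotient.map' (s₁ := σ) (s₂ := τ) id fun _ _ hxy => h.le hxy) := by
    intro q
    obtain ⟨x, rfl⟩ := Quotient.exists_rep q
    exact ⟨Quotient.mk _ x, rfl⟩
  refine lt_of_le_of_ne (Nat.card_le_card_of_surjective _ hs) fun heq => h.not_ge ?_
  intro x y hxy
  have := (Function.Surjective.bijective_of_nat_card_le hs heq.ge).1
  exact Quotient.exact (@this (Quotient.mk σ x) (Quotient.mk σ y) (Quotient.sound hxy))

theorem eq_of_le_of_natCard_le [Finite X] {σ τ : Setoid (Option X)} (h : σ ≤ τ)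
    (hc : Nat.card (Quotient σ) ≤ Nat.card (Quotient τ)) : σ = τ := by
  by_contra hne
  exact absurd (natCard_quotient_lt (lt_of_le_of_ne h hne)) hc.not_gt

theorem natCard_quotient_base [Finite X] (Y : Set X) :
    Nat.card (Quotient (base Y)) = Y.ncard + 1 := by
  have hr : range (collapse Y) = insert none (some '' Y) := by
    ext p
    constructor
    · rintro ⟨(_ | x), rfl⟩
      · exact Or.inl rfl
      · by_cases hx : x ∈ Y
        · rw [collapse_some hx]
          exact Or.inr ⟨x, hx, rfl⟩
        · rw [collapse_some_of_notMem hx]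
          exact Or.inl rfl
    · rintro (rfl | ⟨x, hx, rfl⟩)
      · exact ⟨none, rfl⟩
      · exact ⟨some x, collapse_some hx⟩
  rw [base, Nat.card_congr (Setoid.quotientKerEquivRange _), hr, Nat.card_coe_set_eq,
    Set.ncard_insert_of_notMem (by simp), Set.ncard_image_of_injective _ (Option.some_injective X)]

/-! ### The listed sets are isolated subsemigroups -/

theorem star_mem_dualSymmetric {Y : Set X} {a : PIStar X} (ha : a ∈ dualSymmetric Y) :
    star a ∈ dualSymmetric Y := by
  rw [mem_dualSymmetric_iff] at *
  rw [top_star, bot_star]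
  exact ha.symm

theorem mul_mem_dualSymmetric {Y : Set X} {a b : PIStar X} (ha : a ∈ dualSymmetric Y)
    (hb : b ∈ dualSymmetric Y) : a * b ∈ dualSymmetric Y := by
  -- `Z` describes the zero block x̄ ∪ (X \ Y). Imposed on all three rows it is a union of blocks of
  -- both factors, so the zero block of the product cannot grow.
  let Z : Option X → Prop := fun p => ∀ x, p = some x → x ∉ Y
  have hZ : ∀ {σ : Setoid (Option X)}, ZeroClass Y σ → ∀ p, Z p ↔ σ p none := by
    rintro σ hσ (_ | x)
    · simp [Z]
    · simp [Z, hσ x]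
  let F : Option X ⊕ (Option X ⊕ Option X) → Prop := Sum.elim Z (Sum.elim Z Z)
  have F₁ : ∀ v, F (upper v) = Sum.elim Z Z v := by rintro (x | x) <;> rfl
  have F₂ : ∀ v, F (lower v) = Sum.elim Z Z v := by rintro (x | x) <;> rfl
  have hc : ∀ {c : PIStar X}, c ∈ dualSymmetric Y → ∀ u v, bar c.rel u v →
      Sum.elim Z Z u → Sum.elim Z Z v := by
    intro c hc u v huv
    have key : ∀ v, Sum.elim Z Z v ↔ bar c.rel v (Sum.inl none) := by
      obtain ⟨h₁, h₂⟩ := mem_dualSymmetric_iff.1 hc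
      have h0 := (inImage_bar c).2
      rintro (p | p)
      · exact hZ h₁ p
      · exact (hZ h₂ p).trans ⟨fun h => (bar c.rel).trans h ((bar c.rel).symm h0),
          fun h => (bar c.rel).trans h h0⟩
    rw [key, key]
    exact fun h => (bar c.rel).trans ((bar c.rel).symm huv) h
  have htop : ∀ {a b : PIStar X}, a ∈ dualSymmetric Y → b ∈ dualSymmetric Y →
      ZeroClass Y (a * b).top := by
    intro a b ha hb x
    constructor
    · intro h
      rw [top_rel, bar_mul] at h
      have := natMul_iff.1 ((natMul _ _).symm h) F
        (fun u v huv => by rw [F₁, F₁]; exact hc ha u v huv)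
        (fun u v huv => by rw [F₂, F₂]; exact hc hb u v huv) (fun _ h => by simp at h)
      exact this x rfl
    · intro h
      exact top_le_top_mul a b (((mem_dualSymmetric_iff.1 ha).1 x).2 h)
  refine mem_dualSymmetric_iff.2 ⟨htop ha hb, ?_⟩
  rw [← top_star, star_mul]
  exact htop (star_mem_dualSymmetric hb) (star_mem_dualSymmetric ha)

theorem pow_mem_dualSymmetric {Y : Set X} {a : PIStar X} (ha : a ∈ dualSymmetric Y) {k : ℕ}
    (hk : 1 ≤ k) : a ^ k ∈ dualSymmetric Y := by
  induction k, hk using Nat.le_induction with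
  | base => rwa [pow_one]
  | succ k _ ih =>
    rw [pow_succ]
    exact mul_mem_dualSymmetric ih ha

/-- If the top vertex t is joined to a bottom vertex s', then s' falls into the zero block of a * a
through t' in the middle row. So s is outside Y, which forces s = t, and t is joined to x̄ already
in a. -/
theorem top_of_bot_of_pow_mem {Y : Set X} (hY : ∀ s ∉ Y, ∀ t ∉ Y, s = t) {a : PIStar X} {k : ℕ}
    (hk : 1 ≤ k) (ha : a ^ k ∈ dualSymmetric Y) {t : X} (ht : t ∉ Y)
    (hb : a.bot (some t) none) : a.top (some t) none := by
  obtain ⟨h₁, h₂⟩ := mem_dualSymmetric_iff.1 ha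
  have h0 := (inImage_bar a).2
  obtain ⟨(_ | s), hs⟩ := (isDual_iff.1 (inImage_bar a).1 (Sum.inl (some t))).2
  · exact (bar a.rel).trans hs ((bar a.rel).symm h0)
  · obtain rfl | ⟨j, rfl⟩ : k = 1 ∨ ∃ j, k = j + 2 := by
      rcases k with _ | _ | j
      · omega
      · exact Or.inl rfl
      · exact Or.inr ⟨j, rfl⟩
    · rw [pow_one] at h₁
      exact (h₁ t).2 ht
    · have h : (a * a).bot (some s) none := by
        rw [bot_rel, bar_mul]
        refine (stack _ _).trans (stack_lower (u := Sum.inr (some s)) (v := Sum.inl (some t))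
          ((bar a.rel).symm hs)) ((stack _ _).trans ?_ (stack_lower h0))
        exact stack_upper (u := Sum.inr (some t)) (v := Sum.inr none) hb
      rw [pow_add, pow_two] at h₂
      obtain rfl := hY s ((h₂ s).1 (bot_le_bot_mul _ _ h)) t ht
      exact (bar a.rel).trans hs ((bar a.rel).trans hb ((bar a.rel).symm h0))

theorem mem_dualSymmetric_of_pow_mem {Y : Set X} (hY : ∀ s ∉ Y, ∀ t ∉ Y, s = t) {a : PIStar X}
    {k : ℕ} (hk : 1 ≤ k) (ha : a ^ k ∈ dualSymmetric Y) : a ∈ dualSymmetric Y := by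
  have ha' : (star a) ^ k ∈ dualSymmetric Y := by
    rw [← star_pow]
    exact star_mem_dualSymmetric ha
  obtain ⟨h₁, h₂⟩ := mem_dualSymmetric_iff.1 ha
  have t₁ : ∀ x, a.top (some x) none → x ∉ Y := fun x h => (h₁ x).1 (top_le_top_pow a hk h)
  have t₂ : ∀ x, a.bot (some x) none → x ∉ Y := fun x h => (h₂ x).1 (bot_le_bot_pow a hk h)
  have hiff : ∀ t, a.top (some t) none ↔ a.bot (some t) none := by
    intro t
    constructor
    · intro h
      have := top_of_bot_of_pow_mem hY hk ha' (t₁ t h) (by rwa [bot_star])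
      rwa [top_star] at this
    · exact fun h => top_of_bot_of_pow_mem hY hk ha (t₂ t h) h
  have key : ∀ t ∉ Y, a.top (some t) none := by
    intro t ht
    by_contra hn
    -- Were t missing from the zero block of a, that block would be trivial on both rows. Then a and
    -- all its powers would lie in I*_X, although t is a point of `a ^ k`.
    have hn' : ∀ x, ¬ a.top (some x) none := fun x hx => by
      obtain rfl := hY x (t₁ x hx) t ht
      exact hn hx
    have hu : a ∈ dualSymmetric univ := mem_dualSymmetric_iff.2
      ⟨fun x => by simp [hn' x], fun x => by simp [hn' x, ← hiff x]⟩
    have := ((mem_dualSymmetric_iff.1 (pow_mem_dualSymmetric hu hk)).1 t).1 ((h₁ t).2 ht)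
    exact this (mem_univ t)
  exact mem_dualSymmetric_iff.2 ⟨fun x => ⟨t₁ x, key x⟩,
    fun x => ⟨t₂ x, fun hx => (hiff x).1 (key x hx)⟩⟩

theorem base_univ : base (univ : Set X) = ⊥ := by
  refine le_antisymm ?_ bot_le
  rintro (_ | x) q h
  · rcases q with _ | y
    · exact Setoid.refl' _ _
    · exact absurd (eq_of_base_rel (mem_univ y) ((base univ).symm h)) (by simp)
  · rw [eq_of_base_rel (mem_univ x) h]

/-- Both rows have equally many blocks, so comparability with σ on the bottom row is equality. -/
theorem mem_groupClass_of_top_eq [Finite X] {σ : Setoid (Option X)} {a : PIStar X} (h₁ : a.top = σ)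
    (h₂ : σ ≤ a.bot) : a ∈ groupClass σ :=
  ⟨h₁, (eq_of_le_of_natCard_le h₂ (by rw [← natCard_quotient_top, h₁])).symm⟩

theorem left_mem_groupClass_of_mul_mem [Finite X] {σ : Setoid (Option X)} {a b : PIStar X}
    (h₁ : σ ≤ a.top) (h₂ : σ ≤ a.bot) (h : a * b ∈ groupClass σ) : a ∈ groupClass σ :=
  mem_groupClass_of_top_eq (le_antisymm ((top_le_top_mul a b).trans h.1.le) h₁) h₂

theorem isIsolatedSubsemigroup_dualSymmetric {Y : Set X} (hY : ∀ s ∉ Y, ∀ t ∉ Y, s = t) :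
    IsIsolatedSubsemigroup (dualSymmetric Y) :=
  ⟨⟨_, idem_mem_dualSymmetric_iff.2 (zeroClass_base Y)⟩,
    fun _ ha _ hb => mul_mem_dualSymmetric ha hb, fun _ _ hk => mem_dualSymmetric_of_pow_mem hY hk⟩

theorem base_le_of_mem_dualSymmetric {Y : Set X} {a : PIStar X} (ha : a ∈ dualSymmetric Y) :
    base Y ≤ a.top ∧ base Y ≤ a.bot :=
  ⟨(mem_dualSymmetric_iff.1 ha).1.base_le, (mem_dualSymmetric_iff.1 ha).2.base_le⟩

theorem groupClass_base_subset (Y : Set X) : groupClass (base Y) ⊆ dualSymmetric Y :=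
  fun _ ha => mem_dualSymmetric_iff.2 ⟨ha.1 ▸ zeroClass_base Y, ha.2 ▸ zeroClass_base Y⟩

theorem isIsolatedSubsemigroup_symmetric [Finite X] {Y : Set X} (hY : ∀ s ∉ Y, ∀ t ∉ Y, s = t) :
    IsIsolatedSubsemigroup (symmetric Y) := by
  rw [symmetric_eq]
  refine ⟨⟨_, idem_mem_groupClass _⟩, fun _ ha _ hb => groupClass_mul ha hb, fun a k hk h => ?_⟩
  obtain ⟨h₁, h₂⟩ := base_le_of_mem_dualSymmetric
    (mem_dualSymmetric_of_pow_mem hY hk (groupClass_base_subset Y h))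
  obtain ⟨k, rfl⟩ := Nat.exists_eq_add_of_le' hk
  rw [pow_succ'] at h
  exact left_mem_groupClass_of_mul_mem h₁ h₂ h

theorem isIsolatedSubsemigroup_dualSymmetric_diff [Finite X] {Y : Set X}
    (hY : ∀ s ∉ Y, ∀ t ∉ Y, s = t)
    (hY' : Y.Nontrivial) : IsIsolatedSubsemigroup (dualSymmetric Y \ symmetric Y) := by
  rw [symmetric_eq]
  refine ⟨?_, fun a ha b hb => ⟨mul_mem_dualSymmetric ha.1 hb.1, fun h => ha.2 ?_⟩,
    fun a k hk h => ⟨mem_dualSymmetric_of_pow_mem hY hk h.1, fun h' => h.2 (groupClass_pow h' hk)⟩⟩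
  · obtain ⟨i, hi, j, hj, hij⟩ := hY'
    -- Two blocks only, Y and the zero block; as Y has two elements, this idempotent is not in S_Y.
    let f : Option X → Prop := fun p => ∃ y ∈ Y, p = some y
    have hf : ZeroClass Y (Setoid.ker f) := by
      intro x
      simp [Setoid.ker_def, f]
    refine ⟨idem (Setoid.ker f), idem_mem_dualSymmetric_iff.2 hf, fun h => ?_⟩
    rw [idem_mem_groupClass_iff] at h
    have hr : Setoid.ker f (some i) (some j) := by
      simp [Setoid.ker_def, f, hi, hj]
    rw [h] at hr
    exact hij (Option.some_injective _ (eq_of_base_rel hi hr)).symm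
  · exact left_mem_groupClass_of_mul_mem (base_le_of_mem_dualSymmetric ha.1).1
      (base_le_of_mem_dualSymmetric ha.1).2 h

theorem isIsolatedSubsemigroup_univ_diff [Finite X] [Nonempty X] :
    IsIsolatedSubsemigroup (univ \ symmetric (univ : Set X)) := by
  rw [symmetric_eq, base_univ]
  refine ⟨⟨idem ⊤, mem_univ _, fun h => ?_⟩, fun a ha b hb => ⟨mem_univ _, fun h => ha.2 ?_⟩,
    fun a k hk h => ⟨mem_univ _, fun h' => h.2 (groupClass_pow h' hk)⟩⟩
  · rw [idem_mem_groupClass_iff] at h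
    obtain ⟨x⟩ := ‹Nonempty X›
    have : (⊤ : Setoid (Option X)) (some x) none := trivial
    rw [h] at this
    exact Option.some_ne_none x this
  · exact left_mem_groupClass_of_mul_mem bot_le bot_le h

theorem isIsolatedSubsemigroup_univ : IsIsolatedSubsemigroup (univ : Set (PIStar X)) :=
  ⟨⟨1, mem_univ _⟩, fun _ _ _ _ => mem_univ _, fun _ _ _ _ => mem_univ _⟩

theorem isIsolatedSubsemigroup_groupClass [Finite X] {Y : Set X} (hY : ∀ s ∉ Y, ∀ t ∉ Y, s = t)
    {σ : Setoid (Option X)} (hσ : ZeroClass Y σ) (hc : Nat.card (Quotient σ) = Y.ncard) :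
    IsIsolatedSubsemigroup (groupClass σ) := by
  refine ⟨⟨_, idem_mem_groupClass σ⟩, fun _ ha _ hb => groupClass_mul ha hb, fun a k hk h => ?_⟩
  have hk' : a ^ k ∈ dualSymmetric Y :=
    mem_dualSymmetric_iff.2 ⟨h.1.symm ▸ hσ, h.2.symm ▸ hσ⟩
  have ha := mem_dualSymmetric_of_pow_mem hY hk hk'
  obtain ⟨h₁, h₂⟩ := base_le_of_mem_dualSymmetric ha
  -- Otherwise a, hence `a ^ k`, would have |Y| + 1 blocks, while σ has |Y|. So `a.top` has at most
  -- |Y| blocks and refines σ, which forces equality.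
  have hne : a.top ≠ base Y := by
    intro h'
    have := groupClass_pow (mem_groupClass_of_top_eq h' h₂) hk
    rw [← h.1, this.1, natCard_quotient_base] at hc
    omega
  have hlt := natCard_quotient_lt (lt_of_le_of_ne h₁ hne.symm)
  rw [natCard_quotient_base, Nat.lt_succ_iff] at hlt
  constructor
  · exact eq_of_le_of_natCard_le ((top_le_top_pow a hk).trans h.1.le) (hlt.trans hc.ge)
  · refine eq_of_le_of_natCard_le ((bot_le_bot_pow a hk).trans h.2.le) ?_
    rw [← natCard_quotient_top]
    exact hlt.trans hc.ge

/-! ### Gluing two vertices and splitting one off -/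

open Classical in
/-- The map that sends `j` to `i` and fixes all other elements. -/
noncomputable def redirect {P : Type*} (i j : P) (p : P) : P := if p = j then i else p

theorem redirect_self {P : Type*} (i j : P) : redirect i j j = i := if_pos rfl

theorem redirect_of_ne {P : Type*} {i j p : P} (h : p ≠ j) : redirect i j p = p := if_neg h

/-- The finest partition in which `x̄` and the elements outside `Y` form a block and `i` and `j`
belong to the same block. -/
noncomputable def glue (Y : Set X) (i j : X) : Setoid (Option X) :=
  Setoid.ker (collapse Y ∘ redirect (some i) (some j))

theorem glue_le {Y : Set X} {i j : X} {σ : Setoid (Option X)} (h : base Y ≤ σ)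
    (hij : σ (some i) (some j)) : glue Y i j ≤ σ := by
  have hc : ∀ p, σ p (collapse Y p) := by
    rintro (_ | x)
    · exact σ.refl _
    · by_cases hx : x ∈ Y
      · rw [collapse_some hx]
      · rw [collapse_some_of_notMem hx]
        exact h ((zeroClass_base Y x).2 hx)
  refine ker_le_of fun p => σ.trans ?_ (hc _)
  by_cases hp : p = some j
  · rw [hp, redirect_self]
    exact σ.symm hij
  · rw [redirect_of_ne hp]

theorem glue_rel (Y : Set X) {i j : X} (hij : i ≠ j) : glue Y i j (some i) (some j) := by
  rw [glue, Setoid.ker_def, Function.comp, Function.comp, redirect_self,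
    redirect_of_ne (by simpa using hij)]

theorem base_le_glue (Y : Set X) {i j : X} (hj : j ∈ Y) : base Y ≤ glue Y i j := by
  rw [base_le_iff]
  intro x hx
  rw [glue, Setoid.ker_def, Function.comp, Function.comp, redirect_of_ne, redirect_of_ne (by simp),
    collapse_some_of_notMem hx]
  · rfl
  · rintro h
    exact hx (Option.some_injective _ h ▸ hj)

theorem zeroClass_glue {Y : Set X} {i j : X} (hi : i ∈ Y) (hj : j ∈ Y) :
    ZeroClass Y (glue Y i j) := by
  intro x
  refine ⟨fun h hx => ?_, base_le_iff.1 (base_le_glue Y hj) x⟩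
  rw [glue, Setoid.ker_def, Function.comp, Function.comp, redirect_of_ne (p := none) (by simp)] at h
  by_cases hxj : x = j
  · rw [hxj, redirect_self, collapse_some hi] at h
    simp [collapse] at h
  · rw [redirect_of_ne (by simpa using hxj), collapse_some hx] at h
    simp [collapse] at h

/-- Gluing j to i loses one block of Y, and the zero block restores the count; the rank of the
idempotent is therefore one less than |Y|. -/
theorem natCard_quotient_glue [Finite X] {Y : Set X} {i j : X} (hij : i ≠ j) (hi : i ∈ Y)
    (hj : j ∈ Y) : Nat.card (Quotient (glue Y i j)) = Y.ncard := by
  have hr : range (collapse Y ∘ redirect (some i) (some j)) = insert none (some '' (Y \ {j})) := by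
    ext p
    constructor
    · rintro ⟨(_ | x), rfl⟩
      · rw [Function.comp, redirect_of_ne (by simp)]
        exact Or.inl rfl
      · by_cases hx : x = j
        · rw [Function.comp, hx, redirect_self, collapse_some hi]
          exact Or.inr ⟨i, ⟨hi, hij⟩, rfl⟩
        · rw [Function.comp, redirect_of_ne (by simpa using hx)]
          by_cases hxY : x ∈ Y
          · rw [collapse_some hxY]
            exact Or.inr ⟨x, ⟨hxY, hx⟩, rfl⟩
          · rw [collapse_some_of_notMem hxY]
            exact Or.inl rfl
    · rintro (rfl | ⟨x, ⟨hx, hx'⟩, rfl⟩)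
      · exact ⟨none, by rw [Function.comp, redirect_of_ne (by simp)]; rfl⟩
      · refine ⟨some x, ?_⟩
        rw [Function.comp, redirect_of_ne (by simpa using hx'), collapse_some hx]
  rw [glue, Nat.card_congr (Setoid.quotientKerEquivRange _), hr, Nat.card_coe_set_eq,
    Set.ncard_insert_of_notMem (by simp), Set.ncard_image_of_injective _ (Option.some_injective X),
    Set.ncard_sdiff_singleton_add_one hj]

open Classical in
/-- The partition obtained from `ρ` by splitting `i` off from its block. -/
noncomputable def splitOff (ρ : Setoid (Option X)) (i : Option X) : Setoid (Option X) :=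
  Setoid.ker fun p => if p = i then none else some (Quotient.mk ρ p)

theorem splitOff_rel {ρ : Setoid (Option X)} {i p q : Option X} :
    splitOff ρ i p q ↔ ρ p q ∧ (p = i ↔ q = i) := by
  rw [splitOff, Setoid.ker_def]
  by_cases hp : p = i
  · by_cases hq : q = i
    · subst hp hq
      simp
    · simp [hp, hq]
  · by_cases hq : q = i
    · simp [hp, hq]
    · simp only [hp, hq, if_false, Option.some_inj, iff_self, and_true]
      exact Quotient.eq

theorem splitOff_le (ρ : Setoid (Option X)) (i : Option X) : splitOff ρ i ≤ ρ :=
  fun _ _ h => (splitOff_rel.1 h).1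

end PIStar

open PIStar

/-! ### Idempotents of an isolated subsemigroup and its greatest partition -/

namespace IsIsolatedSubsemigroup

variable {X : Type u} {T : Set (PIStar X)}

theorem idem_sup_mem (hT : IsIsolatedSubsemigroup T) {σ τ : Setoid (Option X)} (hσ : idem σ ∈ T)
    (hτ : idem τ ∈ T) : idem (σ ⊔ τ) ∈ T := by
  rw [← idem_mul_idem]
  exact hT.2.1 _ hσ _ hτ

theorem pow_mem (hT : IsIsolatedSubsemigroup T) {a : PIStar X} (ha : a ∈ T) {k : ℕ}
    (hk : 1 ≤ k) : a ^ k ∈ T := by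
  induction k, hk using Nat.le_induction with
  | base => rwa [pow_one]
  | succ k _ ih =>
    rw [pow_succ]
    exact hT.2.1 _ ih _ ha

variable [Finite X]

/-- An idempotent power of a group element stays in the group, so it is `idem σ`. -/
theorem groupClass_subset (hT : IsIsolatedSubsemigroup T) {σ : Setoid (Option X)}
    (hσ : idem σ ∈ T) : groupClass σ ⊆ T := by
  intro a ha
  obtain ⟨k, hk, τ, h⟩ := exists_pow_eq_idem a
  have := groupClass_pow ha hk
  rw [h, idem_mem_groupClass_iff] at this
  exact hT.2.2 a k hk (by rwa [h, this])

/-- An element and its reflection share an idempotent power, because idempotents are fixed by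
`star`. -/
theorem star_mem (hT : IsIsolatedSubsemigroup T) {a : PIStar X} (ha : a ∈ T) : star a ∈ T := by
  obtain ⟨k, hk, τ, h⟩ := exists_pow_eq_idem a
  refine hT.2.2 _ k hk ?_
  rw [← star_pow, h, star_idem, ← h]
  exact hT.pow_mem ha hk

theorem idem_top_mem (hT : IsIsolatedSubsemigroup T) {a : PIStar X} (ha : a ∈ T) :
    idem a.top ∈ T := by
  rw [← mul_star_self_eq]
  exact hT.2.1 _ ha _ (hT.star_mem ha)

theorem idem_bot_mem (hT : IsIsolatedSubsemigroup T) {a : PIStar X} (ha : a ∈ T) :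
    idem a.bot ∈ T := by
  rw [← top_star]
  exact hT.idem_top_mem (hT.star_mem ha)

theorem exists_greatest (hT : IsIsolatedSubsemigroup T) :
    ∃ m, idem m ∈ T ∧ ∀ ρ, idem ρ ∈ T → ρ ≤ m := by
  have hfin : {ρ : Setoid (Option X) | idem ρ ∈ T}.Finite :=
    (toFinite T).preimage idem_injective.injOn
  obtain ⟨a, ha⟩ := hT.1
  obtain ⟨m, hm⟩ := hfin.exists_maximal ⟨_, hT.idem_top_mem ha⟩
  exact ⟨m, hm.prop, fun ρ hρ => le_sup_left.trans
    (hm.le_of_ge (hT.idem_sup_mem hρ hm.prop) le_sup_right)⟩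

theorem exists_minimal {p : Setoid (Option X) → Prop} (h : ∃ ρ, idem ρ ∈ T ∧ p ρ) :
    ∃ e, (idem e ∈ T ∧ p e) ∧ ∀ ρ, idem ρ ∈ T → p ρ → ρ ≤ e → e ≤ ρ := by
  have hfin : {ρ : Setoid (Option X) | idem ρ ∈ T ∧ p ρ}.Finite :=
    ((toFinite T).preimage idem_injective.injOn).subset fun _ h => h.1
  obtain ⟨m, hm⟩ := hfin.exists_minimal h
  exact ⟨m, hm.prop, fun ρ h₁ h₂ h₃ => hm.le_of_le ⟨h₁, h₂⟩ h₃⟩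

/-- The transposition of two nonzero blocks of e belongs to the group at `idem e`, hence to T. Its
product with `idem m` lies in T and has as top partition the transport of m by this transposition,
which is therefore below m. -/
theorem greatest_of_swap (hT : IsIsolatedSubsemigroup T) {e m : Setoid (Option X)}
    (he : idem e ∈ T) (hm : idem m ∈ T) (hmax : ∀ ρ, idem ρ ∈ T → ρ ≤ m) {c d : Option X}
    (hc : ¬ e c none) (hd : ¬ e d none) [DecidableEq (Quotient e)] {x y x' y' : Option X}
    (hx : Equiv.swap (Quotient.mk e c) (Quotient.mk e d) (Quotient.mk e x) = Quotient.mk e x')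
    (hy : Equiv.swap (Quotient.mk e c) (Quotient.mk e d) (Quotient.mk e y) = Quotient.mk e y')
    (h : m x' y') : m x y := by
  set s := Equiv.swap (Quotient.mk e c) (Quotient.mk e d)
  have hem := hmax e he
  have hq : Function.Surjective (Quotient.mk e) := fun q => Quotient.exists_rep q
  let L : Quotient e → Quotient m := Quotient.map' id fun _ _ h => hem h
  have hL : ∀ p, L (Quotient.mk e p) = Quotient.mk m p := fun _ => rfl
  have hr : range (Quotient.mk e) = range (s ∘ Quotient.mk e) := by
    rw [hq.range_eq, (s.surjective.comp hq).range_eq]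
  have h0 : Quotient.mk e none = (s ∘ Quotient.mk e) none :=
    (Equiv.swap_apply_of_ne_of_ne (fun h => hc (e.symm (Quotient.exact h)))
      (fun h => hd (e.symm (Quotient.exact h)))).symm
  have hker : Setoid.ker (Quotient.mk e) = e := Setoid.ext fun _ _ => Quotient.eq
  have ha : ofMaps _ _ hr h0 ∈ T := by
    refine hT.groupClass_subset he ⟨by rw [top_ofMaps, hker], ?_⟩
    rw [bot_ofMaps]
    refine Eq.trans ?_ hker
    ext p q
    exact s.injective.eq_iff
  have hb := hT.idem_top_mem (hT.2.1 _ ha _ hm)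
  have hk : Quotient.mk m = (L ∘ s) ∘ (s ∘ Quotient.mk e) := by
    funext p
    simp only [Function.comp]
    rw [Equiv.swap_apply_self, hL]
  rw [show idem m = ofMaps _ _ rfl rfl from rfl, ofMaps_mul _ _ _ _ _ hk, top_ofMaps] at hb
  refine hmax _ hb ?_
  rw [Setoid.ker_def]
  simp only [Function.comp]
  rw [hx, hy, hL, hL]
  exact Quotient.sound h

/-- By the invariance under transpositions, if m joins one nonzero block of e to the zero block then
it joins all of them, and if it joins two nonzero blocks then it joins all nonzero blocks together.
-/
theorem greatest_trichotomy (hT : IsIsolatedSubsemigroup T) {e m : Setoid (Option X)}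
    (he : idem e ∈ T) (hm : idem m ∈ T) (hmax : ∀ ρ, idem ρ ∈ T → ρ ≤ m) :
    m = ⊤ ∨ ((∀ p, m p none ↔ e p none) ∧
      (m = e ∨ ∀ p q, ¬ e p none → ¬ e q none → m p q)) := by
  classical
  have hem := hmax e he
  have hne : ∀ {p q}, ¬ e p q → Quotient.mk e p ≠ Quotient.mk e q :=
    fun h h' => h (Quotient.exact h')
  by_cases h : ∃ c, m c none ∧ ¬ e c none
  · left
    obtain ⟨c, hc, hc'⟩ := h
    have key : ∀ d, m d none := by
      intro d
      by_cases hd : e d none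
      · exact hem hd
      · exact hT.greatest_of_swap he hm hmax hc' hd (x := d) (y := none) (x' := c) (y' := none)
          (Equiv.swap_apply_right _ _)
          (Equiv.swap_apply_of_ne_of_ne (hne hc').symm (hne hd).symm) hc
    exact le_antisymm le_top fun {p q} _ => m.trans (key p) (m.symm (key q))
  · right
    have hz : ∀ p, m p none ↔ e p none := fun p =>
      ⟨fun hp => by_contra fun hp' => h ⟨p, hp, hp'⟩, fun hp => hem hp⟩
    refine ⟨hz, ?_⟩
    by_cases hme : m ≤ e
    · exact Or.inl (le_antisymm hme hem)
    · right
      obtain ⟨c, c', hcc, hcc'⟩ : ∃ c c', m c c' ∧ ¬ e c c' := by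
        by_contra hcon
        push Not at hcon
        exact hme fun {p q} => hcon p q
      have hc : ¬ e c none := fun hc => hcc' (e.trans hc
        (e.symm ((hz _).1 (m.trans (m.symm hcc) (hem hc)))))
      have hc' : ¬ e c' none := fun hc' => hc ((hz _).1 (m.trans hcc (hem hc')))
      have key : ∀ d, ¬ e d none → m c d := by
        intro d hd
        by_cases hcd : e c d
        · exact hem hcd
        · exact hT.greatest_of_swap he hm hmax hc' hd (x := c) (y := d) (x' := c) (y' := c')
            (Equiv.swap_apply_of_ne_of_ne (hne hcc') (hne hcd)) (Equiv.swap_apply_right _ _) hcc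
      exact fun p q hp hq => m.trans (m.symm (key p hp)) (key q hq)

/-! ### Descent to finer partitions -/

/-- The element a given by f and g satisfies a * a = (a * idem ρ) * (idem ρ * a), since its two row
partitions join to ρ. Both factors lie in the group at `idem ρ`, so a² ∈ T and isolation yields a ∈
T. -/
theorem idem_ker_mem (hT : IsIsolatedSubsemigroup T) {Q R : Type*} {f g : Option X → Q}
    (hr : range f = range g) (h0 : f none = g none) (k : Q → R) {ρ : Setoid (Option X)}
    (hρ : idem ρ ∈ T) (hf : Setoid.ker (k ∘ f) = ρ) (hg : Setoid.ker (k ∘ g) = ρ)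
    (hsup : ρ ≤ Setoid.ker f ⊔ Setoid.ker g) : idem (Setoid.ker f) ∈ T := by
  have hr' : range (k ∘ f) = range (k ∘ g) := by rw [range_comp, range_comp, hr]
  have hsup' : Setoid.ker g ⊔ Setoid.ker f = ρ := by
    refine le_antisymm (sup_le ?_ ?_) (hsup.trans (sup_comm _ _).le)
    · rw [← hg]
      exact fun {p q} h => congrArg k h
    · rw [← hf]
      exact fun {p q} h => congrArg k h
  have hx : ofMaps (k ∘ f) (k ∘ g) hr' (congrArg k h0) ∈ groupClass ρ :=
    ⟨by rw [top_ofMaps, hf], by rw [bot_ofMaps, hg]⟩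
  have h₁ : ofMaps f g hr h0 * idem ρ = ofMaps (k ∘ f) (k ∘ g) hr' (congrArg k h0) := by
    rw [← hg, ← ofMaps_self, ofMaps_mul _ _ _ _ k rfl]
  have h₂ : idem ρ * ofMaps f g hr h0 = ofMaps (k ∘ f) (k ∘ g) hr' (congrArg k h0) := by
    apply star_injective
    rw [star_mul, star_ofMaps, star_ofMaps, star_idem, ← hf, ← ofMaps_self,
      ofMaps_mul _ _ _ _ k rfl]
  have ha : ofMaps f g hr h0 ∈ T := by
    refine hT.2.2 _ 2 one_le_two (hT.groupClass_subset hρ ?_)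
    have : ofMaps f g hr h0 ^ 2 = (ofMaps f g hr h0 * idem ρ) * (idem ρ * ofMaps f g hr h0) := by
      rw [mul_assoc, ← mul_assoc (idem ρ), idem_mul_idem, sup_idem, pow_two]
      conv_lhs => rw [← mul_idem_bot (ofMaps f g hr h0)]
      conv_lhs => rw [mul_assoc]; arg 2; arg 2; rw [mul_idem_bot, ← idem_top_mul (ofMaps f g hr h0)]
      rw [← mul_assoc (idem _), idem_mul_idem, top_ofMaps, bot_ofMaps, hsup']
    rw [this, h₁, h₂]
    exact groupClass_mul hx hx
  have := hT.idem_top_mem ha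
  rwa [top_ofMaps] at this

/-- Apply `idem_ker_mem` to the element that splits i off on the top row and j off on the bottom
row. The witnesses i' and j' keep the remainders of the blocks nonempty, and i' also reattaches i in
the join, as it is distinct from j. -/
theorem idem_splitOff_mem (hT : IsIsolatedSubsemigroup T) {ρ : Setoid (Option X)}
    (hρ : idem ρ ∈ T) {i j i' j' : Option X} (hij : i ≠ j) (hi : i ≠ none) (hj : j ≠ none)
    (hc : ρ i j ∨ (¬ ρ i none ∧ ¬ ρ j none)) (hi' : ρ i i') (hii : i' ≠ i) (hij' : i' ≠ j)
    (hj' : ρ j j') (hji : j' ≠ i) (hjj : j' ≠ j) : idem (splitOff ρ i) ∈ T := by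
  classical
  -- When i and j lie in different blocks these are exchanged on the bottom row, so that the
  -- split-off vertices i and j' can share a line with matching remainders; in a common block `s` is
  -- the identity.
  set s := Equiv.swap (Quotient.mk ρ i) (Quotient.mk ρ j) with hs
  have hs0 : s (Quotient.mk ρ none) = Quotient.mk ρ none := by
    rcases hc with h | ⟨h, h'⟩
    · rw [hs, Quotient.sound (s := ρ) h, Equiv.swap_self]
      rfl
    · exact Equiv.swap_apply_of_ne_of_ne (fun h₁ => h (ρ.symm (Quotient.exact h₁)))
        (fun h₁ => h' (ρ.symm (Quotient.exact h₁)))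
  let f : Option X → Option (Quotient ρ) := fun p => if p = i then none else some (Quotient.mk ρ p)
  let g : Option X → Option (Quotient ρ) :=
    fun p => if p = j then none else some (s (Quotient.mk ρ p))
  -- The default returns i to its block on the top row, and j on the bottom row too, because `s`
  -- sends the block of j to that of i.
  let k : Option (Quotient ρ) → Quotient ρ := fun o => o.getD (Quotient.mk ρ i)
  have hf : Function.Surjective f := by
    rintro (_ | q)
    · exact ⟨i, if_pos rfl⟩
    · obtain ⟨p, rfl⟩ := Quotient.exists_rep q
      by_cases hp : p = i
      · exact ⟨i', by simp only [f, if_neg hii, hp]; rw [Quotient.sound (s := ρ) hi']⟩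
      · exact ⟨p, if_neg hp⟩
  have hg : Function.Surjective g := by
    rintro (_ | q)
    · exact ⟨j, if_pos rfl⟩
    · obtain ⟨p, hp⟩ := Quotient.exists_rep (s q)
      have hp' : s (Quotient.mk ρ p) = q := by rw [hp, Equiv.swap_apply_self]
      by_cases hpj : p = j
      · refine ⟨j', ?_⟩
        simp only [g, if_neg hjj]
        rw [← Quotient.sound (s := ρ) hj', ← hpj, hp']
      · exact ⟨p, by simp only [g, if_neg hpj, hp']⟩
  have hkf : k ∘ f = Quotient.mk ρ := by
    funext p
    by_cases hp : p = i <;> simp [k, f, hp]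
  have hkg : k ∘ g = s ∘ Quotient.mk ρ := by
    funext p
    by_cases hp : p = j
    · simp [k, g, hp, hs]
    · simp [k, g, hp]
  have hker : Setoid.ker (Quotient.mk ρ) = ρ := Setoid.ext fun _ _ => Quotient.eq
  refine hT.idem_ker_mem (f := f) (g := g) (by rw [hf.range_eq, hg.range_eq]) ?_ k hρ ?_ ?_ ?_
  · simp only [f, g, if_neg hi.symm, if_neg hj.symm, hs0]
  · rw [hkf, hker]
  · rw [hkg]
    exact (Setoid.ext fun _ _ => s.injective.eq_iff).trans hker
  · have hF : ∀ {p q}, ρ p q → p ≠ i → q ≠ i → (Setoid.ker f ⊔ Setoid.ker g) p q := by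
      intro p q h hp hq
      refine (le_sup_left : Setoid.ker f ≤ _) ?_
      simp only [Setoid.ker_def, f, if_neg hp, if_neg hq]
      rw [Quotient.sound (s := ρ) h]
    have hii' : (Setoid.ker f ⊔ Setoid.ker g) i i' := by
      refine (le_sup_right : Setoid.ker g ≤ _) ?_
      simp only [Setoid.ker_def, g, if_neg hij, if_neg hij']
      rw [Quotient.sound (s := ρ) hi']
    have key : ∀ {q}, ρ i q → (Setoid.ker f ⊔ Setoid.ker g) i q := by
      intro q h
      by_cases hq : q = i
      · rw [hq]
      · exact Setoid.trans' _ hii' (hF (ρ.trans (ρ.symm hi') h) hii hq)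
    intro p q h
    by_cases hp : p = i
    · subst hp
      exact key h
    · by_cases hq : q = i
      · subst hq
        exact Setoid.symm' _ (key (ρ.symm h))
      · exact hF h hp hq

/-- ρ is the join of the members of T below it: a maximal such member absorbs every pair related by
ρ. -/
theorem idem_mem_of_forall_exists (hT : IsIsolatedSubsemigroup T) {z ρ : Setoid (Option X)}
    (hz : ∀ κ, idem κ ∈ T → z ≤ κ) (hne : ¬ ρ ≤ z)
    (h : ∀ x y, ρ x y → ¬ z x y → ∃ κ ≤ ρ, idem κ ∈ T ∧ κ x y) : idem ρ ∈ T := by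
  have hex : ∀ {z : Setoid (Option X)}, ¬ ρ ≤ z → ∃ x y, ρ x y ∧ ¬ z x y := by
    intro z hne
    by_contra hcon
    push Not at hcon
    exact hne fun {p q} => hcon p q
  have hfin : {κ : Setoid (Option X) | idem κ ∈ T ∧ κ ≤ ρ}.Finite :=
    ((toFinite T).preimage idem_injective.injOn).subset fun _ h => h.1
  obtain ⟨x, y, hxy, hxy'⟩ := hex hne
  obtain ⟨κ, hκ, hκT, -⟩ := h x y hxy hxy'
  obtain ⟨m, hm⟩ := hfin.exists_maximal ⟨κ, hκT, hκ⟩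
  obtain ⟨hmT, hmρ⟩ : idem m ∈ T ∧ m ≤ ρ := hm.prop
  by_cases hρm : ρ ≤ m
  · rwa [le_antisymm hρm hmρ]
  · obtain ⟨x, y, hxy, hxy'⟩ := hex hρm
    obtain ⟨κ, hκ, hκT, hκxy⟩ := h x y hxy fun h => hxy' (hz m hmT h)
    exact absurd (hm.le_of_ge (y := m ⊔ κ) ⟨hT.idem_sup_mem hmT hκT, sup_le hmρ hκ⟩ le_sup_left
      ((le_sup_right : κ ≤ m ⊔ κ) hκxy)) hxy'

/-! ### The case where ⊤ occurs -/

theorem idem_base_mem (hT : IsIsolatedSubsemigroup T) (h : idem ⊤ ∈ T) (t : X) :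
    idem (base (univ \ {t})) ∈ T := by
  -- Minimal among members whose only nontrivial block is the zero block and contains t. A further
  -- element x of that block could be split off, with `none` as the third vertex.
  obtain ⟨ρ, ⟨hρ, ht, hρ'⟩, hmin⟩ := exists_minimal (T := T)
    (p := fun ρ => ρ (some t) none ∧ ∀ p q, ρ p q → p = q ∨ ρ p none)
    ⟨⊤, h, trivial, fun _ _ _ => Or.inr trivial⟩
  have hz : ZeroClass (univ \ {t}) ρ := by
    intro x
    simp only [mem_sdiff, mem_univ, true_and, mem_singleton_iff, not_not]
    constructor
    · intro hx
      by_contra hxt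
      have hne : some x ≠ some t := fun h => hxt (Option.some_injective _ h)
      have hs := hT.idem_splitOff_mem hρ hne (Option.some_ne_none x) (Option.some_ne_none t)
        (Or.inl (ρ.trans hx (ρ.symm ht))) hx (Option.some_ne_none x).symm
        (Option.some_ne_none t).symm ht (Option.some_ne_none x).symm (Option.some_ne_none t).symm
      have hle := hmin _ hs ⟨splitOff_rel.2 ⟨ht, by simp [Ne.symm hxt]⟩, fun p q hpq => ?_⟩
        (splitOff_le _ _)
      · have := (splitOff_rel.1 (hle hx)).2
        simp at this
      · obtain ⟨h₁, h₂⟩ := splitOff_rel.1 hpq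
        by_cases hp : p = some x
        · exact Or.inl (hp.trans (h₂.1 hp).symm)
        · rcases hρ' p q h₁ with h | h
          · exact Or.inl h
          · exact Or.inr (splitOff_rel.2 ⟨h, by simp [hp]⟩)
    · rintro rfl
      exact ht
  have : ρ = base (univ \ {t}) := by
    refine le_antisymm (le_base_of hz fun x hx y _ hxy => ?_) hz.base_le
    rcases hρ' _ _ hxy with h | h
    · exact Option.some_injective _ h
    · exact absurd hx ((hz x).1 h)
  rwa [← this]

/-- The element with row partitions generated by i ~ j and by j ~ x̄ has its square in the group of
the partition with block {i, j, x̄}, which is the join of two members given by `idem_base_mem`. -/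
theorem idem_ker_redirect_mem (hT : IsIsolatedSubsemigroup T) (h : idem ⊤ ∈ T) {i j : X}
    (hij : i ≠ j) : idem (Setoid.ker (redirect (some i) (some j))) ∈ T := by
  have hk : redirect none (some i) ∘ redirect (some i) (some j) =
      redirect none (some i) ∘ redirect none (some j) := by
    funext p
    by_cases hp : p = some j
    · rw [Function.comp, Function.comp, hp, redirect_self, redirect_self, redirect_self,
        redirect_of_ne (by simp)]
    · rw [Function.comp, Function.comp, redirect_of_ne hp, redirect_of_ne hp]
  have hr : ∀ q : Option X, q ≠ some j →
      range (redirect q (some j)) = {(some j : Option X)}ᶜ := by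
    intro q hq
    ext p
    constructor
    · rintro ⟨r, rfl⟩
      by_cases hr : r = some j
      · rw [hr, redirect_self]
        exact hq
      · rwa [redirect_of_ne hr]
    · exact fun hp => ⟨p, redirect_of_ne hp⟩
  have hρ : idem (Setoid.ker (redirect none (some i) ∘ redirect (some i) (some j))) ∈ T := by
    have := hT.idem_sup_mem (hT.idem_base_mem h i) (hT.idem_base_mem h j)
    convert this using 2
    apply le_antisymm
    · have hi : (base (univ \ {i}) ⊔ base (univ \ {j})) (some i) none :=
        (le_sup_left : base (univ \ {i}) ≤ _) ((zeroClass_base _ i).2 (by simp))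
      have hj : (base (univ \ {i}) ⊔ base (univ \ {j})) (some j) none :=
        (le_sup_right : base (univ \ {j}) ≤ _) ((zeroClass_base _ j).2 (by simp))
      rw [hk]
      refine ker_le_of fun p => ?_
      by_cases hp : p = some j
      · rw [Function.comp, hp, redirect_self, redirect_of_ne (by simp)]
        exact hj
      · rw [Function.comp, redirect_of_ne hp]
        by_cases hp' : p = some i
        · rw [hp', redirect_self]
          exact hi
        · rw [redirect_of_ne hp']
    · rw [hk]
      refine sup_le (base_le_iff.2 ?_) (base_le_iff.2 ?_)
      · intro x hx
        obtain rfl : x = i := by simpa using hx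
        rw [Setoid.ker_def, Function.comp, Function.comp,
          redirect_of_ne (p := some x) (j := some j) (by simpa using hij), redirect_self,
          redirect_of_ne (p := none) (j := some j) (by simp),
          redirect_of_ne (p := none) (j := some x) (by simp)]
      · intro x hx
        obtain rfl : x = j := by simpa using hx
        rw [Setoid.ker_def, Function.comp, Function.comp, redirect_self,
          redirect_of_ne (p := none) (j := some x) (by simp)]
  refine hT.idem_ker_mem (g := redirect none (some j)) ?_ ?_ (redirect none (some i)) hρ rfl
    (by rw [hk]) ?_
  · rw [hr _ (by simpa using hij), hr _ (by simp)]
  · rw [redirect_of_ne (by simp), redirect_of_ne (by simp)]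
  · have hj : (Setoid.ker (redirect (some i) (some j)) ⊔ Setoid.ker (redirect none (some j)))
        (some j) none := by
      refine (le_sup_right : Setoid.ker (redirect none (some j)) ≤ _) ?_
      rw [Setoid.ker_def, redirect_self, redirect_of_ne (by simp)]
    have hi : (Setoid.ker (redirect (some i) (some j)) ⊔ Setoid.ker (redirect none (some j)))
        (some i) (some j) := by
      refine (le_sup_left : Setoid.ker (redirect (some i) (some j)) ≤ _) ?_
      rw [Setoid.ker_def, redirect_self, redirect_of_ne (by simpa using hij)]
    rw [hk]
    refine ker_le_of fun p => ?_
    by_cases hp : p = some j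
    · rw [Function.comp, hp, redirect_self, redirect_of_ne (by simp)]
      exact hj
    · rw [Function.comp, redirect_of_ne hp]
      by_cases hp' : p = some i
      · rw [hp', redirect_self]
        exact Setoid.trans' _ hi hj
      · rw [redirect_of_ne hp']

theorem idem_mem_of_ne_bot (hT : IsIsolatedSubsemigroup T) (h : idem ⊤ ∈ T)
    {σ : Setoid (Option X)} (hσ : σ ≠ ⊥) : idem σ ∈ T := by
  refine hT.idem_mem_of_forall_exists (z := ⊥) (fun _ _ => bot_le) (fun h => hσ (le_bot_iff.1 h)) ?_
  have hz : ∀ x, σ (some x) none → ∃ κ ≤ σ, idem κ ∈ T ∧ κ (some x) none := fun x hx =>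
    ⟨_, base_le_iff.2 fun y hy => by
      obtain rfl : y = x := by simpa using hy
      exact hx, hT.idem_base_mem h x, (zeroClass_base _ x).2 (by simp)⟩
  rintro (_ | x) (_ | y) hxy hne
  · exact absurd (Setoid.refl' _ _) hne
  · obtain ⟨κ, h₁, h₂, h₃⟩ := hz y (σ.symm hxy)
    exact ⟨κ, h₁, h₂, κ.symm h₃⟩
  · exact hz x hxy
  · have hij : x ≠ y := by
      rintro rfl
      exact hne (Setoid.refl' _ _)
    refine ⟨_, ker_le_of fun p => ?_, hT.idem_ker_redirect_mem h hij, ?_⟩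
    · by_cases hp : p = some y
      · rw [hp, redirect_self]
        exact σ.symm hxy
      · rw [redirect_of_ne hp]
    · rw [Setoid.ker_def, redirect_self, redirect_of_ne (by simpa using hij)]

/-- A nonunit has no power equal to `idem ⊥`, so its idempotent power is already known to be in T;
only the units remain undecided, and they enter together. -/
theorem eq_univ_or_eq_univ_diff (hT : IsIsolatedSubsemigroup T) (h : idem ⊤ ∈ T) :
    T = univ ∨ T = univ \ symmetric univ := by
  have key : ∀ a, a ∉ groupClass ⊥ → a ∈ T := by
    intro a ha
    obtain ⟨k, hk, σ, hσ⟩ := exists_pow_eq_idem a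
    refine hT.2.2 a k hk ?_
    rw [hσ]
    refine hT.idem_mem_of_ne_bot h fun h' => ha ?_
    obtain ⟨k, rfl⟩ := Nat.exists_eq_add_of_le' hk
    rw [pow_succ', h'] at hσ
    exact left_mem_groupClass_of_mul_mem bot_le bot_le (b := a ^ k)
      (by rw [hσ]; exact idem_mem_groupClass ⊥)
  by_cases hb : idem ⊥ ∈ T
  · refine Or.inl (eq_univ_of_forall fun a => ?_)
    by_cases ha : a ∈ groupClass ⊥
    · exact hT.groupClass_subset hb ha
    · exact key a ha
  · right
    rw [symmetric_eq, base_univ]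
    ext a
    refine ⟨fun ha => ⟨mem_univ a, fun h' => hb ?_⟩, fun ha => key a ha.2⟩
    have := hT.idem_top_mem ha
    rwa [h'.1] at this

/-! ### The case where ⊤ does not occur -/

/-- Every member has its zero block inside that of m, and by the trichotomy each member's zero block
equals it. In a minimal member this block cannot contain two elements of X, since one could be split
off. -/
theorem exists_zeroClass (hT : IsIsolatedSubsemigroup T) (h : idem ⊤ ∉ T) :
    ∃ Y : Set X, (Y = univ ∨ ∃ t, Y = univ \ {t}) ∧ ∀ ρ, idem ρ ∈ T → ZeroClass Y ρ := by
  obtain ⟨m, hm, hmax⟩ := hT.exists_greatest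
  have hmt : m ≠ ⊤ := fun h' => h (h' ▸ hm)
  by_cases hex : ∃ ρ, idem ρ ∈ T ∧ ∀ x, ¬ ρ (some x) none
  · obtain ⟨ρ, hρ, hρ'⟩ := hex
    have hz := ((hT.greatest_trichotomy hρ hm hmax).resolve_left hmt).1
    refine ⟨univ, Or.inl rfl, fun σ hσ x => ?_⟩
    simp only [mem_univ, not_true_eq_false, iff_false]
    exact fun hx => hρ' x ((hz _).1 (hmax σ hσ hx))
  · push Not at hex
    obtain ⟨ρ, ⟨hρ, -⟩, hmin⟩ := exists_minimal (T := T) (p := fun _ => True) ⟨m, hm, trivial⟩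
    obtain ⟨t, ht⟩ := hex ρ hρ
    have hz := ((hT.greatest_trichotomy hρ hm hmax).resolve_left hmt).1
    have huniq : ∀ x, ρ (some x) none → x = t := by
      intro x hx
      by_contra hxt
      have hne : some x ≠ some t := fun h => hxt (Option.some_injective _ h)
      have hs := hT.idem_splitOff_mem hρ hne (Option.some_ne_none x) (Option.some_ne_none t)
        (Or.inl (ρ.trans hx (ρ.symm ht))) hx (Option.some_ne_none x).symm
        (Option.some_ne_none t).symm ht (Option.some_ne_none x).symm (Option.some_ne_none t).symm
      have := (splitOff_rel.1 (hmin _ hs trivial (splitOff_le _ _) hx)).2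
      simp at this
    refine ⟨univ \ {t}, Or.inr ⟨t, rfl⟩, fun σ hσ => ?_⟩
    have hu : ∀ x, σ (some x) none → x = t := fun x hx => huniq x ((hz _).1 (hmax σ hσ hx))
    intro x
    simp only [mem_sdiff, mem_univ, true_and, mem_singleton_iff, not_not]
    refine ⟨hu x, ?_⟩
    rintro rfl
    obtain ⟨s, hs⟩ := hex σ hσ
    rwa [← hu s hs]

theorem idem_glue_mem (hT : IsIsolatedSubsemigroup T) {Y : Set X}
    (hY : ∀ ρ, idem ρ ∈ T → ZeroClass Y ρ) {m : Setoid (Option X)} (hm : idem m ∈ T)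
    (hm' : ∀ x ∈ Y, ∀ y ∈ Y, m (some x) (some y)) {i j : X} (hij : i ≠ j) (hi : i ∈ Y)
    (hj : j ∈ Y) : idem (glue Y i j) ∈ T := by
  have hpz : ∀ {ρ : Setoid (Option X)} {p q}, ZeroClass Y ρ → ρ p q → ¬ base Y p q →
      ∃ x ∈ Y, p = some x := by
    intro ρ p q hρ hpq hb
    have hz : ∀ p, ρ p none → base Y p none := by
      rintro (_ | x) hx
      · exact Setoid.refl' _ _
      · exact (zeroClass_base Y x).2 ((hρ x).1 hx)
    have hp : ¬ ρ p none := fun hp =>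
      hb ((base Y).trans (hz p hp) ((base Y).symm (hz q (ρ.trans (ρ.symm hpq) hp))))
    rcases p with _ | x
    · exact absurd (Setoid.refl' _ _) hp
    · exact ⟨x, not_not.1 fun hx => hp ((hρ x).2 hx), rfl⟩
  have hne : some i ≠ some j := fun h => hij (Option.some_injective _ h)
  -- Minimal among members with i ~ j whose pairs beyond `base Y` all lie in the block of i; m
  -- qualifies. Any third vertex of that block can be split off.
  obtain ⟨ρ, ⟨hρ, hρij, hρ'⟩, hmin⟩ := exists_minimal (T := T)
    (p := fun ρ => ρ (some i) (some j) ∧ ∀ p q, ρ p q → ¬ base Y p q → ρ p (some i))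
    ⟨m, hm, hm' i hi j hj, fun p q hpq hb => by
      obtain ⟨x, hx, rfl⟩ := hpz (hY m hm) hpq hb
      exact hm' x hx i hi⟩
  have key : ∀ p q, ρ p q → ¬ base Y p q → p = some i ∨ p = some j := by
    intro p q hpq hb
    by_contra hcon
    push Not at hcon
    obtain ⟨hpi, hpj⟩ := hcon
    have hp := hρ' p q hpq hb
    have hp0 : p ≠ none := by
      obtain ⟨x, -, rfl⟩ := hpz (hY ρ hρ) hpq hb
      simp
    have hs := hT.idem_splitOff_mem hρ hpi hp0 (Option.some_ne_none i) (Or.inl hp)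
      (ρ.trans hp hρij) (Ne.symm hpj) hne.symm hρij (Ne.symm hpj) hne.symm
    have hle := hmin _ hs ⟨splitOff_rel.2 ⟨hρij, iff_of_false (Ne.symm hpi) (Ne.symm hpj)⟩,
      fun r s hrs hb' => ?_⟩ (splitOff_le _ _)
    · exact hpi ((splitOff_rel.1 (hle hp)).2.1 rfl).symm
    · obtain ⟨h₁, h₂⟩ := splitOff_rel.1 hrs
      have hr : r ≠ p := fun hr => hb' (by rw [hr, h₂.1 hr])
      exact splitOff_rel.2 ⟨hρ' r s h₁ hb', iff_of_false hr (Ne.symm hpi)⟩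
  have : ρ = glue Y i j := by
    refine le_antisymm (fun p q hpq => ?_) (glue_le (hY ρ hρ).base_le hρij)
    by_cases hb : base Y p q
    · exact base_le_glue Y hj hb
    · rcases key p q hpq hb with rfl | rfl <;>
        rcases key q _ (ρ.symm hpq) (fun h => hb ((base Y).symm h)) with rfl | rfl
      · exact Setoid.refl' _ _
      · exact glue_rel Y hij
      · exact Setoid.symm' _ (glue_rel Y hij)
      · exact Setoid.refl' _ _
  rwa [← this]

/-- In a minimal member with i ~ j, splitting off i must leave no gluing within Y. This excludes a
third vertex in the block of i (`third`) and, by the block-swapping form of `idem_splitOff_mem`, a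
second nontrivial block in Y (`other`). -/
theorem exists_eq_glue (hT : IsIsolatedSubsemigroup T) {Y : Set X}
    (hY : ∀ ρ, idem ρ ∈ T → ZeroClass Y ρ) {e : Setoid (Option X)} (he : idem e ∈ T)
    (hne : e ≠ base Y) (hmin : ∀ ρ, idem ρ ∈ T → ρ ≠ base Y → ρ ≤ e → e ≤ ρ) :
    ∃ i ∈ Y, ∃ j ∈ Y, i ≠ j ∧ e = glue Y i j := by
  obtain ⟨i, hi, j, hj, hij, hne'⟩ : ∃ i ∈ Y, ∃ j ∈ Y, e (some i) (some j) ∧ i ≠ j := by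
    by_contra hcon
    push Not at hcon
    exact hne (le_antisymm (le_base_of (hY e he) hcon) (hY e he).base_le)
  have hij' : some i ≠ some j := fun h => hne' (Option.some_injective _ h)
  have hnz : ∀ x ∈ Y, ¬ e (some x) none := fun x hx h => (hY e he x).1 h hx
  have contra : ∀ x ∈ Y, ∀ y, y ≠ x → e (some x) (some y) → some x ≠ some i → some y ≠ some i →
      idem (splitOff e (some i)) ∉ T := by
    intro x hx y hxy h hxi hyi hs
    have hr : splitOff e (some i) (some x) (some y) :=
      splitOff_rel.2 ⟨h, iff_of_false hxi hyi⟩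
    have := hmin _ hs (fun h' => by
      rw [h'] at hr
      exact hxy (Option.some_injective _ (eq_of_base_rel hx hr))) (splitOff_le _ _)
    exact hij' ((splitOff_rel.1 (this hij)).2.1 rfl).symm
  have third : ∀ l, l ≠ i → l ≠ j → ¬ e (some i) (some l) := by
    intro l hli hlj hl
    have hli' : some l ≠ some i := fun h => hli (Option.some_injective _ h)
    have hlj' : some l ≠ some j := fun h => hlj (Option.some_injective _ h)
    have hjl := e.trans (e.symm hij) hl
    exact contra j hj l hlj hjl hij'.symm hli' (hT.idem_splitOff_mem he hij'
      (Option.some_ne_none i) (Option.some_ne_none j) (Or.inl hij) hl hli' hlj' hjl hli' hlj')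
  have other : ∀ x ∈ Y, ∀ y, x ≠ y → e (some x) (some y) → e (some i) (some x) := by
    intro x hx y hxy h
    by_contra hix
    have hxi : some x ≠ some i := fun h' => hix (by rw [h'])
    have hyi : some y ≠ some i := fun h' => hix (by rw [← h']; exact e.symm h)
    have hjx : some j ≠ some x := fun h' => hix (by rw [← h']; exact hij)
    exact contra x hx y hxy.symm h hxi hyi (hT.idem_splitOff_mem he hxi.symm
      (Option.some_ne_none i) (Option.some_ne_none x) (Or.inr ⟨hnz i hi, hnz x hx⟩) hij hij'.symm
      hjx h hyi (fun h' => hxy (Option.some_injective _ h').symm))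
  refine ⟨i, hi, j, hj, hne', le_antisymm ?_ (glue_le (hY e he).base_le hij)⟩
  have hmem : ∀ x ∈ Y, ∀ y, x ≠ y → e (some x) (some y) → x = i ∨ x = j := by
    intro x hx y hxy h
    by_contra hcon
    push Not at hcon
    exact third x hcon.1 hcon.2 (other x hx y hxy h)
  have hz : ∀ p, e p none → glue Y i j p none := by
    rintro (_ | x) h
    · exact Setoid.refl' _ _
    · exact (zeroClass_glue hi hj x).2 ((hY e he x).1 h)
  have hpos : ∀ p, ¬ e p none → ∃ x ∈ Y, p = some x := by
    rintro (_ | x) h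
    · exact absurd (Setoid.refl' _ _) h
    · exact ⟨x, not_not.1 fun hx => h ((hY e he x).2 hx), rfl⟩
  intro p q hpq
  by_cases hp : e p none
  · exact Setoid.trans' _ (hz p hp) (Setoid.symm' _ (hz q (e.trans (e.symm hpq) hp)))
  · obtain ⟨x, hx, rfl⟩ := hpos p hp
    obtain ⟨y, hy, rfl⟩ := hpos q fun hq => hp (e.trans hpq hq)
    by_cases hxy : x = y
    · rw [hxy]
    · rcases hmem x hx y hxy hpq with rfl | rfl <;>
        rcases hmem y hy _ (Ne.symm hxy) (e.symm hpq) with rfl | rfl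
      · exact absurd rfl hxy
      · exact glue_rel Y hxy
      · exact Setoid.symm' _ (glue_rel Y (Ne.symm hxy))
      · exact absurd rfl hxy

theorem eq_groupClass (hT : IsIsolatedSubsemigroup T) {σ : Setoid (Option X)}
    (h : ∀ ρ, idem ρ ∈ T → ρ = σ) : T = groupClass σ := by
  obtain ⟨a, ha⟩ := hT.1
  have hσ := hT.idem_top_mem ha
  rw [h _ hσ] at hσ
  exact Subset.antisymm (fun b hb => ⟨h _ (hT.idem_top_mem hb), h _ (hT.idem_bot_mem hb)⟩)
    (hT.groupClass_subset hσ)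

theorem eq_of_zeroClass (hT : IsIsolatedSubsemigroup T) {Y : Set X}
    (hY : ∀ ρ, idem ρ ∈ T → ZeroClass Y ρ) (htop : idem ⊤ ∉ T) :
    T = dualSymmetric Y ∨ T = dualSymmetric Y \ symmetric Y ∨ T = symmetric Y ∨
      ∃ i ∈ Y, ∃ j ∈ Y, i ≠ j ∧ T = groupClass (glue Y i j) := by
  by_cases hall : ∀ ρ, idem ρ ∈ T → ρ = base Y
  · right; right; left
    rw [symmetric_eq]
    exact hT.eq_groupClass hall
  push Not at hall
  obtain ⟨e, ⟨he, hne⟩, hmin⟩ := exists_minimal (T := T) hall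
  obtain ⟨i, hi, j, hj, hij, rfl⟩ := hT.exists_eq_glue hY he hne hmin
  obtain ⟨m, hm, hmax⟩ := hT.exists_greatest
  have hmt : m ≠ ⊤ := fun h' => htop (h' ▸ hm)
  -- If m merges all of Y, then every `glue Y i j` occurs, and their joins give all partitions with
  -- this zero block other than `base Y`.
  have big : (∀ x ∈ Y, ∀ y ∈ Y, m (some x) (some y)) →
      T = dualSymmetric Y ∨ T = dualSymmetric Y \ symmetric Y := by
    intro hm'
    have hsub : T ⊆ dualSymmetric Y := fun a ha => mem_dualSymmetric_iff.2
      ⟨hY _ (hT.idem_top_mem ha), hY _ (hT.idem_bot_mem ha)⟩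
    have hidem : ∀ ρ, ZeroClass Y ρ → ρ ≠ base Y → idem ρ ∈ T := by
      intro ρ hρ hρ'
      refine hT.idem_mem_of_forall_exists (z := base Y) (fun κ hκ => (hY κ hκ).base_le)
        (fun h => hρ' (le_antisymm h hρ.base_le)) fun p q hpq hb => ?_
      have hz : ∀ p, ρ p none → base Y p none := by
        rintro (_ | x) hx
        · exact Setoid.refl' _ _
        · exact (zeroClass_base Y x).2 ((hρ x).1 hx)
      have hpos : ∀ p, ¬ ρ p none → ∃ x ∈ Y, p = some x := by
        rintro (_ | x) h
        · exact absurd (Setoid.refl' _ _) h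
        · exact ⟨x, not_not.1 fun hx => h ((hρ x).2 hx), rfl⟩
      have hp : ¬ ρ p none := fun hp =>
        hb ((base Y).trans (hz p hp) ((base Y).symm (hz q (ρ.trans (ρ.symm hpq) hp))))
      obtain ⟨x, hx, rfl⟩ := hpos p hp
      obtain ⟨y, hy, rfl⟩ := hpos q fun hq => hp (ρ.trans hpq hq)
      have hxy : x ≠ y := by
        rintro rfl
        exact hb (Setoid.refl' _ _)
      exact ⟨_, glue_le hρ.base_le hpq, hT.idem_glue_mem hY hm hm' hxy hx hy, glue_rel Y hxy⟩
    have key : ∀ a ∈ dualSymmetric Y, a ∉ groupClass (base Y) → a ∈ T := by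
      intro a ha ha'
      obtain ⟨k, hk, σ, hσ⟩ := exists_pow_eq_idem a
      refine hT.2.2 a k hk ?_
      have hz := pow_mem_dualSymmetric ha hk
      rw [hσ, idem_mem_dualSymmetric_iff] at hz
      rw [hσ]
      refine hidem σ hz fun h' => ha' ?_
      obtain ⟨k, rfl⟩ := Nat.exists_eq_add_of_le' hk
      rw [pow_succ', h'] at hσ
      exact left_mem_groupClass_of_mul_mem (base_le_of_mem_dualSymmetric ha).1
        (base_le_of_mem_dualSymmetric ha).2 (b := a ^ k)
        (by rw [hσ]; exact idem_mem_groupClass _)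
    rw [symmetric_eq]
    by_cases hb : idem (base Y) ∈ T
    · refine Or.inl (Subset.antisymm hsub fun a ha => ?_)
      by_cases ha' : a ∈ groupClass (base Y)
      · exact hT.groupClass_subset hb ha'
      · exact key a ha ha'
    · refine Or.inr (Subset.antisymm (fun a ha => ⟨hsub ha, fun h' => hb ?_⟩)
        fun a ha => key a ha.1 ha.2)
      have := hT.idem_top_mem ha
      rwa [h'.1] at this
  have hbig : ∀ {ρ : Setoid (Option X)}, idem ρ ∈ T →
      (∀ p q, ¬ ρ p none → ¬ ρ q none → m p q) →
      ∀ x ∈ Y, ∀ y ∈ Y, m (some x) (some y) := fun hρ h x hx y hy =>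
    h _ _ (fun hx' => (hY _ hρ x).1 hx' hx) (fun hy' => (hY _ hρ y).1 hy' hy)
  -- If m is the minimal member itself, the presence of `base Y` would still force m to merge all of
  -- Y; without `base Y` only one partition is left, and T is a single group.
  rcases ((hT.greatest_trichotomy he hm hmax).resolve_left hmt).2 with hme | hme
  · by_cases hb : idem (base Y) ∈ T
    · rcases ((hT.greatest_trichotomy hb hm hmax).resolve_left hmt).2 with h | h
      · exact absurd (hme.symm.trans h) hne
      · rcases big (hbig hb h) with h | h
        · exact Or.inl h
        · exact Or.inr (Or.inl h)
    · right; right; right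
      refine ⟨i, hi, j, hj, hij, hT.eq_groupClass fun ρ hρ => ?_⟩
      have hle : ρ ≤ glue Y i j := hme ▸ hmax ρ hρ
      exact le_antisymm hle (hmin ρ hρ (fun h => hb (h ▸ hρ)) hle)
  · rcases big (hbig he hme) with h | h
    · exact Or.inl h
    · exact Or.inr (Or.inl h)

end IsIsolatedSubsemigroup

/-! ### Assembling the two directions -/

namespace PIStar

theorem isIsolatedSubsemigroup_of_mem_list {X : Type u} [Finite X] {Y : Set X}
    (hY : ∀ s ∉ Y, ∀ t ∉ Y, s = t) (hY' : Y.Nontrivial) {T : Set (PIStar X)}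
    (h : T = dualSymmetric Y ∨ T = dualSymmetric Y \ symmetric Y ∨ T = symmetric Y ∨
      ∃ e ∈ dualSymmetric Y, IsIdempotentElem e ∧ e.rank = Y.ncard - 1 ∧
        T = maximalSubgroup e) : IsIsolatedSubsemigroup T := by
  rcases h with rfl | rfl | rfl | ⟨e, he, hid, hr, rfl⟩
  · exact isIsolatedSubsemigroup_dualSymmetric hY
  · exact isIsolatedSubsemigroup_dualSymmetric_diff hY hY'
  · exact isIsolatedSubsemigroup_symmetric hY
  · obtain ⟨σ, rfl⟩ := eq_idem_of_isIdempotentElem hid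
    rw [maximalSubgroup_idem]
    refine isIsolatedSubsemigroup_groupClass hY (idem_mem_dualSymmetric_iff.1 he) ?_
    have := rank_add_one (idem σ)
    rw [top_idem, hr] at this
    have := (Set.ncard_pos (toFinite Y)).2 hY'.nonempty
    omega

theorem mem_list_of_zeroClass {X : Type u} [Finite X] {Y : Set X} {T : Set (PIStar X)}
    (hT : IsIsolatedSubsemigroup T) (hY : ∀ ρ, idem ρ ∈ T → ZeroClass Y ρ) (htop : idem ⊤ ∉ T) :
    T = dualSymmetric Y ∨ T = dualSymmetric Y \ symmetric Y ∨ T = symmetric Y ∨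
      ∃ e ∈ dualSymmetric Y, IsIdempotentElem e ∧ e.rank = Y.ncard - 1 ∧
        T = maximalSubgroup e := by
  rcases hT.eq_of_zeroClass hY htop with h | h | h | ⟨i, hi, j, hj, hij, h⟩
  · exact Or.inl h
  · exact Or.inr (Or.inl h)
  · exact Or.inr (Or.inr (Or.inl h))
  · refine Or.inr (Or.inr (Or.inr ⟨idem (glue Y i j),
      idem_mem_dualSymmetric_iff.2 (zeroClass_glue hi hj), ?_, ?_, ?_⟩))
    · exact (idem_mul_idem _ _).trans (by rw [sup_idem])
    · have := rank_add_one (idem (glue Y i j))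
      rw [top_idem, natCard_quotient_glue hij hi hj] at this
      omega
    · rw [h, maximalSubgroup_idem]

end PIStar

end PartitionDiagram

theorem mainTheorem11 (n : ℕ) (hn : 3 ≤ n) (T : Set (PartitionDiagram.PIStar (Fin n))) :
    PartitionDiagram.IsIsolatedSubsemigroup T ↔
      (T = PartitionDiagram.PIStar.dualSymmetric Set.univ ∨
        T = PartitionDiagram.PIStar.dualSymmetric Set.univ \
          PartitionDiagram.PIStar.symmetric Set.univ ∨
        T = PartitionDiagram.PIStar.symmetric Set.univ ∨
        ∃ e ∈ PartitionDiagram.PIStar.dualSymmetric (Set.univ : Set (Fin n)),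
          IsIdempotentElem e ∧ e.rank = n - 1 ∧ T = PartitionDiagram.maximalSubgroup e) ∨
      (∃ (t : Fin n) (Y : Set (Fin n)), Y = Set.univ \ {t} ∧
        (T = PartitionDiagram.PIStar.dualSymmetric Y ∨
          T = PartitionDiagram.PIStar.dualSymmetric Y \ PartitionDiagram.PIStar.symmetric Y ∨
          T = PartitionDiagram.PIStar.symmetric Y ∨
          ∃ e ∈ PartitionDiagram.PIStar.dualSymmetric Y,
            IsIdempotentElem e ∧ e.rank = n - 2 ∧ T = PartitionDiagram.maximalSubgroup e)) ∨
      (T = Set.univ ∨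
        T = Set.univ \ PartitionDiagram.PIStar.symmetric Set.univ) := by
  have hcard : (Set.univ : Set (Fin n)).ncard = n := by simp [Set.ncard_univ]
  have hcard' : ∀ t : Fin n, (Set.univ \ {t} : Set (Fin n)).ncard = n - 1 := fun t => by
    rw [Set.ncard_sdiff_singleton_of_mem (Set.mem_univ t), hcard]
  -- Since 3 ≤ n, at least two elements remain even after one is deleted, so I*_Y \ S_Y is nonempty.
  have hnt : ∀ Y : Set (Fin n), n - 1 ≤ Y.ncard → Y.Nontrivial := fun Y hY =>
    (Set.one_lt_ncard_iff_nontrivial).1 (by omega)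
  have : Nonempty (Fin n) := ⟨⟨0, by omega⟩⟩
  constructor
  · intro hT
    by_cases htop : PartitionDiagram.PIStar.idem ⊤ ∈ T
    · exact Or.inr (Or.inr (hT.eq_univ_or_eq_univ_diff htop))
    · obtain ⟨Y, rfl | ⟨t, rfl⟩, hY⟩ := hT.exists_zeroClass htop
      · have := PartitionDiagram.PIStar.mem_list_of_zeroClass hT hY htop
        rw [hcard] at this
        exact Or.inl this
      · have := PartitionDiagram.PIStar.mem_list_of_zeroClass hT hY htop
        rw [hcard' t, Nat.sub_sub] at this
        exact Or.inr (Or.inl ⟨t, _, rfl, this⟩)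
  · rintro (h | ⟨t, Y, rfl, h⟩ | rfl | rfl)
    · refine PartitionDiagram.PIStar.isIsolatedSubsemigroup_of_mem_list (Y := Set.univ)
        (fun s hs => absurd (Set.mem_univ s) hs) (hnt _ (by omega)) ?_
      rwa [hcard]
    · refine PartitionDiagram.PIStar.isIsolatedSubsemigroup_of_mem_list (Y := Set.univ \ {t})
        (fun s hs r hr => ?_) (hnt _ (hcard' t).ge) ?_
      · simp only [Set.mem_sdiff, Set.mem_univ, true_and, Set.mem_singleton_iff, not_not] at hs hr
        rw [hs, hr]
      · rwa [hcard' t, Nat.sub_sub]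
    · exact PartitionDiagram.PIStar.isIsolatedSubsemigroup_univ
    · exact PartitionDiagram.PIStar.isIsolatedSubsemigroup_univ_diff
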